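/- **Setting.** For a cdf $F$ let $F^{-1}(u)=\inf\{x\in\mathbb R: F(x)\ge u\}\in[-\infty,\infty]$. For cdfs $F,G$ let $\mathcal W_2(F,G)=\big(\int_0^1 (F^{-1}(u)-G^{-1}(u))^2du\big)^{1/2}$ and $$\varepsilon_{\mathcal W_2}(F,G)=\frac{\int_{\{u\in(0,1):\,F^{-1}(u)>G^{-1}(u)\}}(F^{-1}(u)-G^{-1}(u))^2\,du}{\mathcal W_2^2(F,G)},$$ with $\varepsilon_{\mathcal W_2}(F,G)=0$ if $\mathcal W_2(F,G)=0$, and $\varepsilon_{\mathcal W_2}(F,G)=1$ if the numerator is infinite. For sequences of random variables, $X_n\le_{\text{d-ast}}Y_n$ as $n\to\infty$ means $\lim_{n\to\infty}\varepsilon_{\mathcal W_2}(F_{X_n},F_{Y_n})=0$. Let $p\in\mathbb N$, let $\alpha_1,\dots,\alpha_p>0$ with $\sum_i\alpha_i=1$, let $\gamma_1,\dots,\gamma_p\in[0,1]$, and let $\gamma_{i,n}\in[0,1]$ with $|\gamma_{i,n}-\gamma_i|=O(1/n)$ as $n\to\infty$ for each $i$. Put $$\phi_n(u)=\sum_{i=1}^p\alpha_i\sum_{j=1+[(n-1)\gamma_{i,n}]}^{n}\binom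 nj u^j(1-u)^{n-j},\qquad u\in[0,1].$$ Call $\delta_1,\dots,\delta_p>0$ *admissible* if, for every $i$ and all $a,b\in[0,1]$ with $\gamma_i-\delta_i\le a<b<\gamma_i$ or $\gamma_i<b<a\le\gamma_i+\delta_i$, one has $\phi_n'(a)/\phi_n'(b)\to0$ as $n\to\infty$ (with one-sided derivatives at $0$ and $1$). **Theorem.** (1) Admissible $\delta_1,\dots,\delta_p$ exist. (2) Let $\delta_1,\dots,\delta_p$ be admissible, and let $F_X,F_Y$ be continuous cdfs, strictly increasing on $\mathbb R$, with finite second moments. Let $B_0=\{x:F_X(x)<F_Y(x)\}$, $B_2=\{x:F_X(x)\ne F_Y(x)\}$, $A_2=\{u\in(0,1):F_X^{-1}(u)\ne F_Y^{-1}(u)\}$, and for $\gamma\in[0,1]$ let $$c_\gamma=\sup\big(B_0\cap(-\infty,F_X^{-1}(\gamma))\big),\quad a_\gamma=\sup\big(B_2\cap(-\infty,F_X^{-1}(\gamma))\big),$$ $$d_\gamma=\inf\big(B_0\cap(F_X^{-1}(\gamma),\infty)\big),\quad b_\gamma=\inf\big(B_2\cap(F_X^{-1}(\gamma),\infty)\big),$$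 in $[-\infty,\infty]$, where $\sup\emptyset=-\infty$, $\inf\emptyset=\infty$, $F_X(-\infty)=0$ and $F_X(\infty)=1$. Assume that for every $i\in\{1,\dots,p\}$: * (A1) $\max\{F_X(c_{\gamma_i}),\gamma_i-\delta_i\}<F_X(a_{\gamma_i})$ whenever $A_2\cap(0,\gamma_i)\ne\emptyset$; * (A2) $F_X(b_{\gamma_i})<\min\{F_X(d_{\gamma_i}),\gamma_i+\delta_i\}$ whenever $A_2\cap(\gamma_i,1)\ne\emptyset$. For every $n\ge1$ let $X_n$ and $Y_n$ be random variables with cdfs $\sum_{i=1}^p\alpha_iF_{X_{(1+[(n-1)\gamma_{i,n}]):n}}$ and $\sum_{i=1}^p\alpha_iF_{Y_{(1+[(n-1)\gamma_{i,n}]):n}}$, where $F_{X_{k:n}}$ (resp. $F_{Y_{k:n}}$) is the cdf of the $k$-th smallest of $n$ independent observations from $F_X$ (resp. $F_Y$). Then $X_n\le_{\text{d-ast}}Y_n$ as $n\to\infty$. -/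

import Mathlib

open Set Filter Topology MeasureTheory ProbabilityTheory Asymptotics
open scoped ENNReal

namespace DepartureOrder

noncomputable section

/-- The left-continuous inverse `inf {x : F x ≥ u}` of `F`, as an extended real number
(so that the inverse of a strictly increasing cdf is `-∞` at `0` and `+∞` at `1`). -/
def quantile (F : ℝ → ℝ) (u : ℝ) : EReal :=
  sInf ((fun x : ℝ => (x : EReal)) '' {x : ℝ | u ≤ F x})

/-- The left-continuous inverse as a real number; it is meant for `u ∈ (0,1)`, where the
inverse of a cdf is finite. -/
def quantileReal (F : ℝ → ℝ) (u : ℝ) : ℝ := (quantile F u).toReal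

/-- The `L₂`-Wasserstein distance of two cdfs, through their quantile functions. -/
def wasserstein2 (F G : ℝ → ℝ) : ℝ≥0∞ :=
  (∫⁻ u in Ioo (0 : ℝ) 1, ENNReal.ofReal ((quantileReal F u - quantileReal G u) ^ 2)) ^ (1 / 2 : ℝ)

/-- `A₀`: the levels `u ∈ (0,1)` at which the quantile of `F` exceeds the quantile of `G`. -/
def setA0 (F G : ℝ → ℝ) : Set ℝ := {u | u ∈ Ioo (0 : ℝ) 1 ∧ quantileReal G u < quantileReal F u}

/-- `A₂`: the levels `u ∈ (0,1)` at which the two quantiles differ. -/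
def setA2 (F G : ℝ → ℝ) : Set ℝ := {u | u ∈ Ioo (0 : ℝ) 1 ∧ quantileReal F u ≠ quantileReal G u}

/-- `∫_{A₀} (F⁻¹ - G⁻¹)²`, the violation of the usual stochastic order of `F` below `G`. -/
def violation (F G : ℝ → ℝ) : ℝ≥0∞ :=
  ∫⁻ u in setA0 F G, ENNReal.ofReal ((quantileReal F u - quantileReal G u) ^ 2)

open Classical in
/-- The measure of departure from the usual stochastic order of `F` below `G`. It is `0` when the
Wasserstein distance vanishes, and `1` when the violation is infinite. -/
def departure (F G : ℝ → ℝ) : ℝ≥0∞ :=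
  if wasserstein2 F G = 0 then 0
  else if violation F G = ⊤ then 1
  else violation F G / wasserstein2 F G ^ 2

/-- The departure-based asymptotic stochastic order `X n ≤ Y n` as `n → ∞`, for two sequences of
random variables; the `X n` and the `Y n` may live on different probability spaces. -/
def DAstLE {Ω Ω' : ℕ → Type*} [∀ n, MeasurableSpace (Ω n)] [∀ n, MeasurableSpace (Ω' n)]
    (P : ∀ n, Measure (Ω n)) (X : ∀ n, Ω n → ℝ)
    (Q : ∀ n, Measure (Ω' n)) (Y : ∀ n, Ω' n → ℝ) : Prop :=
  Tendsto (fun n => departure (cdf ((P n).map (X n))) (cdf ((Q n).map (Y n)))) atTop (𝓝 0)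

/-- The `k`-th smallest entry of `v`, for `1 ≤ k ≤ n`. -/
def orderStat {n : ℕ} (v : Fin n → ℝ) (k : ℕ) : ℝ :=
  if h : k - 1 < n then v (Tuple.sort v ⟨k - 1, h⟩) else 0

/-- The cdf of the `k`-th order statistic of a random sample of size `n` from `μ`. -/
def orderStatCDF (μ : Measure ℝ) (n k : ℕ) (x : ℝ) : ℝ :=
  (Measure.pi (fun _ : Fin n => μ)).real {v | orderStat v k ≤ x}

/-- The rank `1 + [(n-1) g]`, for `n ≥ 1` and `g ∈ [0,1]`. -/
def rank (n : ℕ) (g : ℝ) : ℕ := 1 + ⌊((n : ℝ) - 1) * g⌋₊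

/-- The mixture with weights `α i` of the cdfs of the order statistics of ranks
`1 + [(n-1) g i]` of a random sample of size `n` from `μ`. -/
def mixtureCDF {p : ℕ} (α g : Fin p → ℝ) (μ : Measure ℝ) (n : ℕ) (x : ℝ) : ℝ :=
  ∑ i, α i * orderStatCDF μ n (rank n (g i)) x

/-- The distortion function of the order statistic of rank `1 + [(n-1) g]`. -/
def distortion (n : ℕ) (g u : ℝ) : ℝ :=
  ∑ j ∈ Finset.Icc (rank n g) n, (n.choose j : ℝ) * u ^ j * (1 - u) ^ (n - j)

/-- The distortion function of the mixture. -/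
def mixtureDistortion {p : ℕ} (α g : Fin p → ℝ) (n : ℕ) (u : ℝ) : ℝ :=
  ∑ i, α i * distortion n (g i) u

/-- The numbers `δ i > 0` are radii around the points `γ i` within which, in `[0,1]`, the
derivative of `φ n` at a point further from `γ i` is asymptotically negligible relative to the one
at a point nearer to `γ i` on the same side. (The `φ n` of this file are polynomials, so
`deriv` at `0` and `1` is the one-sided limit of the derivative from within `(0,1)`.) -/
def ConcentrationRadii {p : ℕ} (φ : ℕ → ℝ → ℝ) (γ δ : Fin p → ℝ) : Prop :=
  ∀ i, 0 < δ i ∧ ∀ a ∈ Icc (0 : ℝ) 1, ∀ b ∈ Icc (0 : ℝ) 1,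
    ((γ i - δ i ≤ a ∧ a < b ∧ b < γ i) ∨ (γ i < b ∧ b < a ∧ a ≤ γ i + δ i)) →
      Tendsto (fun n => deriv (φ n) a / deriv (φ n) b) atTop (𝓝 0)

open Classical in
/-- A cdf extended to `[-∞, ∞]` by the values `0` at `-∞` and `1` at `∞`. -/
def extendCDF (F : ℝ → ℝ) (z : EReal) : ℝ :=
  if z = ⊥ then 0 else if z = ⊤ then 1 else F z.toReal

/-- `B₀`. -/
def setB0 (F G : ℝ → ℝ) : Set ℝ := {x | F x < G x}

/-- `B₂`. -/
def setB2 (F G : ℝ → ℝ) : Set ℝ := {x | F x ≠ G x}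

/-- The supremum in `[-∞, ∞]` of the part of `B` to the left of the `g`-quantile of `F`. -/
def supLeft (F : ℝ → ℝ) (B : Set ℝ) (g : ℝ) : EReal :=
  sSup ((fun x : ℝ => (x : EReal)) '' {x ∈ B | (x : EReal) < quantile F g})

/-- The infimum in `[-∞, ∞]` of the part of `B` to the right of the `g`-quantile of `F`. -/
def infRight (F : ℝ → ℝ) (B : Set ℝ) (g : ℝ) : EReal :=
  sInf ((fun x : ℝ => (x : EReal)) '' {x ∈ B | quantile F g < (x : EReal)})

/-- `c_g`. -/
def pointC (F G : ℝ → ℝ) (g : ℝ) : EReal := supLeft F (setB0 F G) g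

/-- `d_g`. -/
def pointD (F G : ℝ → ℝ) (g : ℝ) : EReal := infRight F (setB0 F G) g

/-- `a_g`. -/
def pointA (F G : ℝ → ℝ) (g : ℝ) : EReal := supLeft F (setB2 F G) g

/-- `b_g`. -/
def pointB (F G : ℝ → ℝ) (g : ℝ) : EReal := infRight F (setB2 F G) g

/-- Condition (A1): agreement of the baseline cdfs with the order on the left of each `γ i`. -/
def CondA1 {p : ℕ} (F G : ℝ → ℝ) (γ δ : Fin p → ℝ) : Prop :=
  ∀ i, (setA2 F G ∩ Ioo 0 (γ i)).Nonempty →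
    max (extendCDF F (pointC F G (γ i))) (γ i - δ i) < extendCDF F (pointA F G (γ i))

/-- Condition (A2): agreement of the baseline cdfs with the order on the right of each `γ i`. -/
def CondA2 {p : ℕ} (F G : ℝ → ℝ) (γ δ : Fin p → ℝ) : Prop :=
  ∀ i, (setA2 F G ∩ Ioo (γ i) 1).Nonempty →
    extendCDF F (pointB F G (γ i)) < min (extendCDF F (pointD F G (γ i))) (γ i + δ i)

end

end DepartureOrder

/-! The cdf of `X n` is the distortion `φ n` applied to the baseline cdf, and similarly for `Y n`.
The quantile of `φ ∘ F` at level `φ v` is that of `F` at `v`, so substituting `u = φ v` turns the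
violation and the squared Wasserstein distance into integrals of the same fixed weight, the squared
gap of the baseline quantiles, against the density `φ n'`, over `A₀` and over `(0,1)`
(`violation_comp`, `wasserstein2_comp_sq`). It remains to see that `φ n'` gives `A₀` a vanishing
share of the weight.

The derivative is a mixture of order statistic densities. Each is unimodal with mode tending to `γ
i`, and its value at `u` decays at exponential rate equal to the relative entropy of Bernoulli(`γ
i`) with respect to Bernoulli(`u`) (`tendsto_log_orderDensity`). Left of `γ i`, the set `A₀` stays
below `F(c)`, while (A1) supplies an interval of `A₂` strictly between `F(c)` and `γ i`; being
nearer the mode, it dominates exponentially (`negligibleOn_left`). The right side is symmetric. The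
resulting inequality is linear in the density, so it passes to the mixture
(`negligibleOn_mixtureDensity`).

The same rates give admissible radii: close to `γ i`, components centred elsewhere have relative
entropy bounded away from zero, while that of component `i` is near zero and increases with the
distance from `γ i` on each side. -/

namespace DepartureOrder

noncomputable section

/-! ### Bernoulli cross entropy and the density of a uniform order statistic -/

/-- The negative of the cross entropy of the Bernoulli laws with parameters `y` and `u`. -/
def crossLog (y u : ℝ) : ℝ := y * Real.log u + (1 - y) * Real.log (1 - u)

/-- The density of the order statistic of rank `q + 1` of a uniform sample of size `m + 1`. -/
def orderDensity (m q : ℕ) (u : ℝ) : ℝ :=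
  ((m : ℝ) + 1) * (m.choose q : ℝ) * u ^ q * (1 - u) ^ (m - q)

lemma crossLog_symm (y u : ℝ) : crossLog (1 - y) (1 - u) = crossLog y u := by
  simp only [crossLog, sub_sub_cancel]; ring

/-- Apply `log t ≤ t - 1` to `u / v` and `(1 - u) / (1 - v)`. The weighted bounds add up to `(v -
u)(v - y) / (v (1 - v)) ≤ 0`, and strictness comes from the first logarithm, whose weight `y` is
positive. -/
lemma crossLog_lt_of_lt_of_le {y u v : ℝ} (hu : 0 < u) (huv : u < v) (hvy : v ≤ y)
    (hv : v < 1) (hy : y ≤ 1) : crossLog y u < crossLog y v := by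
  have hv0 : 0 < v := hu.trans huv
  have h1 : Real.log u - Real.log v < u / v - 1 := by
    rw [← Real.log_div hu.ne' hv0.ne']
    exact Real.log_lt_sub_one_of_pos (by positivity) (by rw [Ne, div_eq_one_iff_eq hv0.ne']; exact huv.ne)
  have h2 : Real.log (1 - u) - Real.log (1 - v) ≤ (1 - u) / (1 - v) - 1 := by
    rw [← Real.log_div (by linarith) (by linarith)]
    exact Real.log_le_sub_one_of_pos (div_pos (by linarith) (by linarith))
  have h3 : y * (u / v - 1) + (1 - y) * ((1 - u) / (1 - v) - 1)
      = (v - u) * (v - y) / (v * (1 - v)) := by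
    have : 1 - v ≠ 0 := by linarith
    field_simp
    ring
  have h4 : (v - u) * (v - y) / (v * (1 - v)) ≤ 0 :=
    div_nonpos_of_nonpos_of_nonneg
      (mul_nonpos_of_nonneg_of_nonpos (by linarith) (by linarith))
      (mul_nonneg hv0.le (by linarith))
  have h5 := mul_lt_mul_of_pos_left h1 (hv0.trans_le hvy)
  have h6 := mul_le_mul_of_nonneg_left h2 (sub_nonneg.2 hy)
  simp only [crossLog]
  linarith

lemma crossLog_lt_of_le_of_lt {y u v : ℝ} (hv : 0 < v) (hyv : y ≤ v) (hvu : v < u)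
    (hu : u < 1) (hy : 0 ≤ y) : crossLog y u < crossLog y v := by
  rw [← crossLog_symm y u, ← crossLog_symm y v]
  exact crossLog_lt_of_lt_of_le (by linarith) (by linarith) (by linarith) (by linarith)
    (by linarith)

lemma mul_log_sub_le {y u : ℝ} (hy : 0 ≤ y) (hu : 0 < u) :
    y * Real.log u + y * Real.log y⁻¹ ≤ u - y := by
  rcases hy.eq_or_lt with rfl | hy
  · simpa using hu.le
  · have h := Real.log_le_sub_one_of_pos (div_pos hu hy)
    rw [Real.log_div hu.ne' hy.ne'] at h
    rw [Real.log_inv]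
    have h2 := mul_le_mul_of_nonneg_left h hy.le
    have h3 : y * (u / y - 1) = u - y := by field_simp
    linarith

/-- Gibbs' inequality. -/
lemma crossLog_add_binEntropy_nonpos {y u : ℝ} (hy : y ∈ Icc (0 : ℝ) 1) (hu : u ∈ Ioo (0 : ℝ) 1) :
    crossLog y u + Real.binEntropy y ≤ 0 := by
  have h1 := mul_log_sub_le hy.1 hu.1
  have h2 := mul_log_sub_le (sub_nonneg.2 hy.2) (sub_pos.2 hu.2)
  simp only [crossLog, Real.binEntropy]
  linarith

lemma crossLog_self (y : ℝ) : crossLog y y = -Real.binEntropy y := by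
  simp only [crossLog, Real.binEntropy, Real.log_inv]; ring

/-- Gibbs' inequality is used at a point strictly between `u` and `y`, and strict monotonicity
towards `y` does the rest. Evaluation at `y` itself, possibly `0` or `1`, is avoided. -/
lemma crossLog_add_binEntropy_neg {y u : ℝ} (hy : y ∈ Icc (0 : ℝ) 1) (hu : u ∈ Ioo (0 : ℝ) 1)
    (hne : u ≠ y) : crossLog y u + Real.binEntropy y < 0 := by
  rcases hne.lt_or_gt with h | h
  · obtain ⟨v, huv, hvy⟩ := exists_between h
    have h1 := crossLog_lt_of_lt_of_le hu.1 huv hvy.le (hvy.trans_le hy.2) hy.2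
    have h2 := crossLog_add_binEntropy_nonpos hy
      (⟨hu.1.trans huv, hvy.trans_le hy.2⟩ : v ∈ Ioo (0 : ℝ) 1)
    linarith
  · obtain ⟨v, hyv, hvu⟩ := exists_between h
    have h1 := crossLog_lt_of_le_of_lt (hy.1.trans_lt hyv) hyv.le hvu hu.2 hy.1
    have h2 := crossLog_add_binEntropy_nonpos hy
      (⟨hy.1.trans_lt hyv, hvu.trans hu.2⟩ : v ∈ Ioo (0 : ℝ) 1)
    linarith

lemma pow_mul_pow_eq_exp {m q : ℕ} (hm : 0 < m) (hq : q ≤ m) {u : ℝ} (hu : u ∈ Ioo (0 : ℝ) 1) :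
    u ^ q * (1 - u) ^ (m - q) = Real.exp (m * crossLog ((q : ℝ) / m) u) := by
  have hm' : (m : ℝ) ≠ 0 := by positivity
  have h : (m : ℝ) * crossLog ((q : ℝ) / m) u
      = q * Real.log u + ((m - q : ℕ) : ℝ) * Real.log (1 - u) := by
    rw [Nat.cast_sub hq, crossLog]; field_simp
  rw [h, Real.exp_add, Real.exp_nat_mul, Real.exp_nat_mul, Real.exp_log hu.1,
    Real.exp_log (sub_pos.2 hu.2)]

lemma orderDensity_eq_exp {m q : ℕ} (hm : 0 < m) (hq : q ≤ m) {u : ℝ} (hu : u ∈ Ioo (0 : ℝ) 1) :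
    orderDensity m q u
      = ((m : ℝ) + 1) * (m.choose q : ℝ) * Real.exp (m * crossLog ((q : ℝ) / m) u) := by
  rw [← pow_mul_pow_eq_exp hm hq hu, orderDensity]; ring

lemma orderDensity_nonneg (m q : ℕ) {u : ℝ} (hu : u ∈ Icc (0 : ℝ) 1) : 0 ≤ orderDensity m q u := by
  have h0 := hu.1
  have h1 := sub_nonneg.2 hu.2
  unfold orderDensity; positivity

lemma orderDensity_pos {m q : ℕ} (hq : q ≤ m) {u : ℝ} (hu : u ∈ Ioo (0 : ℝ) 1) :
    0 < orderDensity m q u := by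
  have h0 := hu.1
  have h1 := sub_pos.2 hu.2
  have h2 : 0 < m.choose q := Nat.choose_pos hq
  unfold orderDensity; positivity

lemma choose_mul_pow_le_one {m q : ℕ} (hq : q ≤ m) {u : ℝ} (hu : u ∈ Icc (0 : ℝ) 1) :
    (m.choose q : ℝ) * (u ^ q * (1 - u) ^ (m - q)) ≤ 1 := by
  have h : ∑ k ∈ Finset.range (m + 1), u ^ k * (1 - u) ^ (m - k) * (m.choose k : ℝ) = 1 := by
    rw [← add_pow]; simp
  have h1 := sub_nonneg.2 hu.2
  have h0 := hu.1
  rw [mul_comm]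
  refine le_of_le_of_eq ?_ h
  exact Finset.single_le_sum (f := fun k => u ^ k * (1 - u) ^ (m - k) * (m.choose k : ℝ))
    (fun k _ => by positivity) (Finset.mem_range.2 (Nat.lt_succ_of_le hq))

lemma orderDensity_le {m q : ℕ} (hq : q ≤ m) {u : ℝ} (hu : u ∈ Icc (0 : ℝ) 1) :
    orderDensity m q u ≤ (m : ℝ) + 1 := by
  have h := mul_le_mul_of_nonneg_left (choose_mul_pow_le_one hq hu) (by positivity : (0 : ℝ) ≤ m + 1)
  rw [mul_one] at h
  refine le_of_eq_of_le ?_ h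
  rw [orderDensity]; ring

lemma continuous_orderDensity (m q : ℕ) : Continuous (orderDensity m q) := by
  unfold orderDensity; fun_prop

/-! ### Derivative and endpoint values of the distortion -/

/-- A tail of the binomial expansion, as a function of the parameter. -/
lemma hasDerivAt_sum_choose (m : ℕ) : ∀ k q : ℕ, q + k = m → ∀ u : ℝ,
    HasDerivAt (fun u : ℝ => ∑ j ∈ Finset.Icc (1 + q) (m + 1),
      ((m + 1).choose j : ℝ) * u ^ j * (1 - u) ^ (m + 1 - j)) (orderDensity m q u) u := by
  -- Induction on `k = m - q`, the number of terms beyond the lowest one.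
  intro k
  induction k with
  | zero =>
    intro q hq u
    have hq : q = m := by omega
    subst hq
    have h : HasDerivAt (fun u : ℝ => u ^ (q + 1)) (((q + 1 : ℕ) : ℝ) * u ^ q) u := by
      simpa using hasDerivAt_pow (q + 1) u
    simpa [add_comm 1 q, orderDensity] using h
  | succ k ih =>
    intro q hq u
    have h1 := ih (q + 1) (by omega) u
    -- The lowest term differentiates to a difference of consecutive densities, so the sum
    -- telescopes.
    have h2 : HasDerivAt (fun u : ℝ => ((m + 1).choose (1 + q) : ℝ) * u ^ (1 + q)
        * (1 - u) ^ (m + 1 - (1 + q)))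
        (orderDensity m q u - orderDensity m (q + 1) u) u := by
      have e1 : m + 1 - (1 + q) = (m - (q + 1)) + 1 := by omega
      have e2 : m - q = (m - (q + 1)) + 1 := by omega
      have d1 : HasDerivAt (fun u : ℝ => u ^ (1 + q)) (((q + 1 : ℕ) : ℝ) * u ^ q) u := by
        simpa [add_comm 1 q] using hasDerivAt_pow (q + 1) u
      have d2 : HasDerivAt (fun u : ℝ => (1 - u) ^ ((m - (q + 1)) + 1))
          (((m - (q + 1) + 1 : ℕ) : ℝ) * (1 - u) ^ (m - (q + 1)) * (-1)) u := by
        exact ((hasDerivAt_id u).const_sub 1).pow ((m - (q + 1)) + 1)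
      have d3 := (d1.const_mul ((m + 1).choose (1 + q) : ℝ)).mul d2
      rw [e1]
      refine d3.congr_deriv ?_
      have c1 : ((m : ℝ) + 1) * (m.choose q : ℝ) = ((m + 1).choose (1 + q) : ℝ) * (q + 1) := by
        have := Nat.add_one_mul_choose_eq m q
        rw [add_comm 1 q]
        exact_mod_cast this
      have c2 : ((m : ℝ) + 1) * (m.choose (q + 1) : ℝ)
          = ((m + 1).choose (1 + q) : ℝ) * ((m - (q + 1) + 1 : ℕ) : ℝ) := by
        have := Nat.choose_mul_succ_eq m (q + 1)
        rw [add_comm 1 q]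
        have e3 : m + 1 - (q + 1) = m - (q + 1) + 1 := by omega
        rw [e3] at this
        rw [mul_comm]
        exact_mod_cast this
      simp only [orderDensity]
      rw [c1, c2, e2, add_comm 1 q]
      push_cast
      ring
    have h3 := h2.add h1
    have h4 : (fun u : ℝ => ∑ j ∈ Finset.Icc (1 + q) (m + 1),
        ((m + 1).choose j : ℝ) * u ^ j * (1 - u) ^ (m + 1 - j)) =
        (fun u : ℝ => ((m + 1).choose (1 + q) : ℝ) * u ^ (1 + q) * (1 - u) ^ (m + 1 - (1 + q)))
        + (fun u : ℝ => ∑ j ∈ Finset.Icc (1 + (q + 1)) (m + 1),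
        ((m + 1).choose j : ℝ) * u ^ j * (1 - u) ^ (m + 1 - j)) := by
      funext u
      have h5 : Finset.Ioc (1 + q) (m + 1) = Finset.Icc (1 + (q + 1)) (m + 1) := by
        ext j
        simp only [Finset.mem_Ioc, Finset.mem_Icc]
        omega
      rw [Pi.add_apply, ← Finset.add_sum_Ioc_eq_sum_Icc (by omega), h5]
    rw [h4]
    refine h3.congr_deriv (by ring)

/-- The index `⌊m g⌋`, one less than the rank in a sample of size `m + 1`. -/
def lowerIndex (m : ℕ) (g : ℝ) : ℕ := ⌊(m : ℝ) * g⌋₊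

lemma rank_succ (m : ℕ) (g : ℝ) : rank (m + 1) g = 1 + lowerIndex m g := by
  simp [rank, lowerIndex]

lemma lowerIndex_le (m : ℕ) {g : ℝ} (hg : g ≤ 1) : lowerIndex m g ≤ m :=
  Nat.floor_le_of_le (mul_le_of_le_one_right (by positivity) hg)

lemma hasDerivAt_distortion (m : ℕ) {g : ℝ} (hg : g ≤ 1) (u : ℝ) :
    HasDerivAt (distortion (m + 1) g) (orderDensity m (lowerIndex m g) u) u := by
  have hle := lowerIndex_le m hg
  have := hasDerivAt_sum_choose m (m - lowerIndex m g) (lowerIndex m g) (by omega) u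
  rw [← rank_succ] at this
  exact this

lemma distortion_zero (n : ℕ) (g : ℝ) : distortion n g 0 = 0 := by
  refine Finset.sum_eq_zero fun j hj => ?_
  have : j ≠ 0 := by
    have := (Finset.mem_Icc.1 hj).1
    unfold rank at this
    omega
  simp [this]

lemma distortion_one (m : ℕ) {g : ℝ} (hg : g ≤ 1) : distortion (m + 1) g 1 = 1 := by
  have hle := lowerIndex_le m hg
  rw [distortion, rank_succ, Finset.sum_eq_single (m + 1)]
  · simp
  · intro j hj hne
    have : m + 1 - j ≠ 0 := by
      have := (Finset.mem_Icc.1 hj).2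
      omega
    simp [this]
  · intro h
    exact absurd (Finset.mem_Icc.2 ⟨by omega, le_rfl⟩) h

/-! ### Entropy bounds, exponential rates and unimodality -/

/-- A single binomial probability with success parameter `q / m` is at most `1`. The cases `q = 0`
and `q = m` are apart because the exponential form needs an interior parameter. -/
lemma choose_le_exp_binEntropy {m q : ℕ} (hm : 0 < m) (hq : q ≤ m) :
    (m.choose q : ℝ) ≤ Real.exp (m * Real.binEntropy ((q : ℝ) / m)) := by
  rcases Nat.eq_zero_or_pos q with rfl | h0
  · simp
  rcases hq.eq_or_lt with rfl | h1
  · have : (q : ℝ) ≠ 0 := by positivity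
    simp [div_self this]
  have hm' : (0 : ℝ) < m := by exact_mod_cast hm
  have hy : (q : ℝ) / m ∈ Ioo (0 : ℝ) 1 :=
    ⟨by positivity, (div_lt_one hm').2 (by exact_mod_cast h1)⟩
  have h := choose_mul_pow_le_one hq (Ioo_subset_Icc_self hy)
  rw [pow_mul_pow_eq_exp hm hq hy, crossLog_self, mul_neg, Real.exp_neg,
    ← div_eq_mul_inv, div_le_one (Real.exp_pos _)] at h
  exact h

/-- The distortion climbs from `0` to `1`, so by the mean value theorem its density equals `1` at
some `u`; Gibbs' inequality bounds the exponential factor there. Taking `g = q / m` makes the floor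
exactly `q`. -/
lemma exp_binEntropy_le_choose {m q : ℕ} (hm : 0 < m) (hq : q ≤ m) :
    Real.exp (m * Real.binEntropy ((q : ℝ) / m)) ≤ ((m : ℝ) + 1) * (m.choose q : ℝ) := by
  have hm' : (0 : ℝ) < m := by exact_mod_cast hm
  have hy : (q : ℝ) / m ∈ Icc (0 : ℝ) 1 :=
    ⟨by positivity, (div_le_one hm').2 (by exact_mod_cast hq)⟩
  have hfl : lowerIndex m ((q : ℝ) / m) = q := by
    rw [lowerIndex, mul_div_cancel₀ _ hm'.ne', Nat.floor_natCast]
  have hd := hasDerivAt_distortion m hy.2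
  obtain ⟨u, hu, hu'⟩ := exists_hasDerivAt_eq_slope (distortion (m + 1) ((q : ℝ) / m)) _
    zero_lt_one (fun x _ => (hd x).continuousAt.continuousWithinAt) (fun x _ => hd x)
  rw [distortion_zero, distortion_one m hy.2, hfl, orderDensity_eq_exp hm hq hu] at hu'
  have hg := crossLog_add_binEntropy_nonpos hy hu
  have h1 : (m : ℝ) * crossLog ((q : ℝ) / m) u ≤ -(m * Real.binEntropy ((q : ℝ) / m)) := by
    rw [← mul_neg]
    exact mul_le_mul_of_nonneg_left (by linarith) hm'.le
  have h2 := mul_le_mul_of_nonneg_left (Real.exp_le_exp.2 h1)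
    (by positivity : (0 : ℝ) ≤ ((m : ℝ) + 1) * (m.choose q : ℝ))
  rw [hu', Real.exp_neg, ← div_eq_mul_inv, le_div_iff₀ (Real.exp_pos _)] at h2
  simpa using h2

lemma tendsto_lowerIndex_div {g : ℕ → ℝ} {γ : ℝ} (hg : ∀ n, 0 ≤ g n)
    (h : Tendsto g atTop (𝓝 γ)) :
    Tendsto (fun m : ℕ => (lowerIndex m (g m) : ℝ) / m) atTop (𝓝 γ) := by
  have h1 : Tendsto (fun m : ℕ => g m - 1 / (m : ℝ)) atTop (𝓝 γ) := by
    simpa using h.sub tendsto_one_div_atTop_nhds_zero_nat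
  refine tendsto_of_tendsto_of_tendsto_of_le_of_le' h1 h ?_ ?_
  · filter_upwards [eventually_gt_atTop 0] with m hm
    have hm' : (0 : ℝ) < m := by exact_mod_cast hm
    have := Nat.lt_floor_add_one ((m : ℝ) * g m)
    rw [le_div_iff₀ hm', sub_mul, one_div, inv_mul_cancel₀ hm'.ne', lowerIndex]
    linarith
  · filter_upwards [eventually_gt_atTop 0] with m hm
    have hm' : (0 : ℝ) < m := by exact_mod_cast hm
    rw [div_le_iff₀ hm', mul_comm]
    exact Nat.floor_le (by have := hg m; positivity)

/-- The limit is minus the relative entropy of Bernoulli(`γ`) with respect to Bernoulli(`u`). The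
constant `(m + 1) * choose` lies between `exp (m H)` and `(m + 1) exp (m H)`, with `H` the entropy
at `q m / m`, and the factor `m + 1` is invisible after `log` and division by `m`. -/
lemma tendsto_log_orderDensity {q : ℕ → ℕ} {γ u : ℝ} (hq : ∀ m, q m ≤ m)
    (h : Tendsto (fun m : ℕ => (q m : ℝ) / m) atTop (𝓝 γ)) (hu : u ∈ Ioo (0 : ℝ) 1) :
    Tendsto (fun m : ℕ => Real.log (orderDensity m (q m) u) / m) atTop
      (𝓝 (crossLog γ u + Real.binEntropy γ)) := by
  have hL : Tendsto (fun m : ℕ => crossLog ((q m : ℝ) / m) u + Real.binEntropy ((q m : ℝ) / m))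
      atTop (𝓝 (crossLog γ u + Real.binEntropy γ)) := by
    have hc : Continuous fun y => crossLog y u + Real.binEntropy y := by
      have := Real.binEntropy_continuous
      unfold crossLog; fun_prop
    exact (hc.tendsto γ).comp h
  have hU : Tendsto (fun m : ℕ => Real.log ((m : ℝ) + 1) / m) atTop (𝓝 0) := by
    have h1 : Tendsto (fun m : ℕ => Real.log ((m : ℝ) + 1) / ((m : ℝ) + 1)) atTop (𝓝 0) :=
      (Real.isLittleO_log_id_atTop.tendsto_div_nhds_zero).comp
        (tendsto_atTop_add_const_right _ 1 tendsto_natCast_atTop_atTop)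
    have h2 : Tendsto (fun m : ℕ => 1 + 1 / (m : ℝ)) atTop (𝓝 1) := by
      simpa using tendsto_one_div_atTop_nhds_zero_nat.const_add (1 : ℝ)
    have h3 := h1.mul h2
    rw [zero_mul] at h3
    refine h3.congr' ?_
    filter_upwards [eventually_gt_atTop 0] with m hm
    have hm' : (0 : ℝ) < m := by exact_mod_cast hm
    field_simp
  have hLU := hL.add hU
  rw [add_zero] at hLU
  have key : ∀ m : ℕ, 0 < m → Real.log (orderDensity m (q m) u) / m
      = Real.log (((m : ℝ) + 1) * (m.choose (q m) : ℝ)) / m + crossLog ((q m : ℝ) / m) u := by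
    intro m hm
    have hm' : (0 : ℝ) < m := by exact_mod_cast hm
    have hc : 0 < m.choose (q m) := Nat.choose_pos (hq m)
    rw [orderDensity_eq_exp hm (hq m) hu, Real.log_mul (by positivity) (Real.exp_ne_zero _),
      Real.log_exp]
    field_simp
  refine tendsto_of_tendsto_of_tendsto_of_le_of_le' hL hLU ?_ ?_
  · filter_upwards [eventually_gt_atTop 0] with m hm
    have hm' : (0 : ℝ) < m := by exact_mod_cast hm
    have h1 := Real.log_le_log (Real.exp_pos _) (exp_binEntropy_le_choose hm (hq m))
    rw [Real.log_exp] at h1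
    have h2 : Real.binEntropy ((q m : ℝ) / m)
        ≤ Real.log (((m : ℝ) + 1) * (m.choose (q m) : ℝ)) / m := by
      rw [le_div_iff₀ hm']; linarith
    rw [key m hm]
    linarith
  · filter_upwards [eventually_gt_atTop 0] with m hm
    have hm' : (0 : ℝ) < m := by exact_mod_cast hm
    have hc : 0 < m.choose (q m) := Nat.choose_pos (hq m)
    have h1 := Real.log_le_log (by positivity) (choose_le_exp_binEntropy hm (hq m))
    rw [Real.log_exp] at h1
    rw [key m hm, Real.log_mul (by positivity) (by positivity), add_div]
    have h2 : Real.log (m.choose (q m) : ℝ) / m ≤ Real.binEntropy ((q m : ℝ) / m) := by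
      rw [div_le_iff₀ hm']; linarith
    linarith

lemma tendsto_orderDensity_div {q r : ℕ → ℕ} {γ η a b : ℝ} (hq : ∀ m, q m ≤ m)
    (hr : ∀ m, r m ≤ m)
    (hγ : Tendsto (fun m : ℕ => (q m : ℝ) / m) atTop (𝓝 γ))
    (hη : Tendsto (fun m : ℕ => (r m : ℝ) / m) atTop (𝓝 η))
    (ha : a ∈ Ioo (0 : ℝ) 1) (hb : b ∈ Ioo (0 : ℝ) 1)
    (hlt : crossLog γ a + Real.binEntropy γ < crossLog η b + Real.binEntropy η) :
    Tendsto (fun m => orderDensity m (q m) a / orderDensity m (r m) b) atTop (𝓝 0) := by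
  have h1 := (tendsto_log_orderDensity hq hγ ha).sub (tendsto_log_orderDensity hr hη hb)
  have h2 := h1.neg_mul_atTop (sub_neg.2 hlt) (tendsto_natCast_atTop_atTop (R := ℝ))
  refine (Real.tendsto_exp_atBot.comp h2).congr' ?_
  filter_upwards [eventually_gt_atTop 0] with m hm
  have hm' : (m : ℝ) ≠ 0 := by positivity
  have hpa := orderDensity_pos (hq m) ha
  have hpb := orderDensity_pos (hr m) hb
  have : (Real.log (orderDensity m (q m) a) / m - Real.log (orderDensity m (r m) b) / m) * m
      = Real.log (orderDensity m (q m) a) - Real.log (orderDensity m (r m) b) := by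
    field_simp
  rw [Function.comp_apply, this, Real.exp_sub, Real.exp_log hpa, Real.exp_log hpb]

/-- With its counterpart on the right, this is unimodality with mode `q / m`, valid for each finite
`m`. It makes pointwise rates usable uniformly over whole sets. -/
lemma orderDensity_le_of_le_left {m q : ℕ} (hm : 0 < m) (hq : q ≤ m) {u v : ℝ} (hu : 0 < u)
    (huv : u ≤ v) (hv : v < 1) (hvq : v ≤ (q : ℝ) / m) :
    orderDensity m q u ≤ orderDensity m q v := by
  have hm' : (0 : ℝ) < m := by exact_mod_cast hm
  rcases huv.eq_or_lt with rfl | h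
  · exact le_rfl
  rw [orderDensity_eq_exp hm hq ⟨hu, h.trans hv⟩, orderDensity_eq_exp hm hq ⟨hu.trans h, hv⟩]
  have := crossLog_lt_of_lt_of_le hu h hvq hv ((div_le_one hm').2 (by exact_mod_cast hq))
  gcongr

lemma orderDensity_le_of_le_right {m q : ℕ} (hm : 0 < m) (hq : q ≤ m) {u v : ℝ} (hv : 0 < v)
    (hvu : v ≤ u) (hu : u < 1) (hqv : (q : ℝ) / m ≤ v) :
    orderDensity m q u ≤ orderDensity m q v := by
  rcases hvu.eq_or_lt with rfl | h
  · exact le_rfl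
  rw [orderDensity_eq_exp hm hq ⟨hv.trans h, hu⟩, orderDensity_eq_exp hm hq ⟨hv, h.trans hu⟩]
  have := crossLog_lt_of_le_of_lt hv hqv h hu (by positivity)
  gcongr

/-! ### Mixture densities and the existence of admissible radii -/

/-- The derivative of `mixtureDistortion` for the sample size `m + 1`. -/
def mixtureDensity {p : ℕ} (α g : Fin p → ℝ) (m : ℕ) (u : ℝ) : ℝ :=
  ∑ i, α i * orderDensity m (lowerIndex m (g i)) u

lemma hasDerivAt_mixtureDistortion {p : ℕ} (α : Fin p → ℝ) {g : Fin p → ℝ} (hg : ∀ i, g i ≤ 1)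
    (m : ℕ) (u : ℝ) :
    HasDerivAt (mixtureDistortion α g (m + 1)) (mixtureDensity α g m u) u := by
  have h : mixtureDistortion α g (m + 1) = fun u => ∑ i, α i * distortion (m + 1) (g i) u := rfl
  rw [h]
  exact HasDerivAt.fun_sum fun i _ => (hasDerivAt_distortion m (hg i) u).const_mul (α i)

lemma mul_orderDensity_le_mixtureDensity {p : ℕ} {α : Fin p → ℝ} (hα : ∀ i, 0 < α i)
    (g : Fin p → ℝ) (m : ℕ) (i : Fin p) {u : ℝ} (hu : u ∈ Icc (0 : ℝ) 1) :
    α i * orderDensity m (lowerIndex m (g i)) u ≤ mixtureDensity α g m u :=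
  Finset.single_le_sum (f := fun i => α i * orderDensity m (lowerIndex m (g i)) u)
    (fun j _ => mul_nonneg (hα j).le (orderDensity_nonneg _ _ hu)) (Finset.mem_univ i)

/-- When `γ` is `0` or `1`, the logarithm singular at `γ` has coefficient zero. -/
lemma continuousAt_crossLog_self {γ : ℝ} (hγ : γ ∈ Icc (0 : ℝ) 1) :
    ContinuousAt (crossLog γ) γ := by
  have h1 : ContinuousAt (fun u => γ * Real.log u) γ := by
    rcases eq_or_ne γ 0 with rfl | h
    · simpa using continuousAt_const
    · exact (Real.continuousAt_log h).const_mul γ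
  have h2 : ContinuousAt (fun u => (1 - γ) * Real.log (1 - u)) γ := by
    rcases eq_or_ne γ 1 with rfl | h
    · simpa using continuousAt_const
    · have : ContinuousAt (fun u : ℝ => Real.log (1 - u)) γ :=
        ContinuousAt.log (by fun_prop) (sub_ne_zero.2 h.symm)
      exact this.const_mul (1 - γ)
  exact h1.add h2

/-- Near `γ`, the divergence from any other parameter `η` exceeds the divergence from `γ`. -/
lemma eventually_divergence_lt {γ η : ℝ} (hγ : γ ∈ Icc (0 : ℝ) 1) (hη : η ∈ Icc (0 : ℝ) 1)
    (hne : η ≠ γ) :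
    ∀ᶠ δ in 𝓝[>] (0 : ℝ), ∀ a ∈ Ioo (0 : ℝ) 1, ∀ b ∈ Ioo (0 : ℝ) 1, |a - γ| ≤ δ → |b - γ| ≤ δ →
      crossLog η a + Real.binEntropy η < crossLog γ b + Real.binEntropy γ := by
  have key : ∃ v < (0 : ℝ), ∀ᶠ a in 𝓝 γ, a ∈ Ioo (0 : ℝ) 1 →
      crossLog η a + Real.binEntropy η ≤ v := by
    -- The midpoint is interior even if `γ` and `η` are endpoints. Its exponent serves as the
    -- threshold `v`: points on the `γ` side of it are further from `η` and have smaller exponent.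
    have hx : (η + γ) / 2 ∈ Ioo (0 : ℝ) 1 := by
      rcases hne.lt_or_gt with h | h <;> constructor <;> linarith [hγ.1, hγ.2, hη.1, hη.2]
    refine ⟨_, crossLog_add_binEntropy_neg hη hx (fun h => hne (by linarith)), ?_⟩
    rcases hne.lt_or_gt with h | h
    · filter_upwards [lt_mem_nhds (show (η + γ) / 2 < γ by linarith)] with a ha ha1
      have := crossLog_lt_of_le_of_lt hx.1 (by linarith) ha ha1.2 hη.1
      linarith
    · filter_upwards [gt_mem_nhds (show γ < (η + γ) / 2 by linarith)] with a ha ha1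
      have := crossLog_lt_of_lt_of_le ha1.1 ha (by linarith) hx.2 hη.2
      linarith
  obtain ⟨v, hv, h1⟩ := key
  have h2 : ∀ᶠ b in 𝓝 γ, v < crossLog γ b + Real.binEntropy γ := by
    have hc : ContinuousAt (fun b => crossLog γ b + Real.binEntropy γ) γ :=
      (continuousAt_crossLog_self hγ).add_const _
    refine hc.eventually_const_lt ?_
    simpa [crossLog_self] using hv
  obtain ⟨r, hr, hr'⟩ := Metric.eventually_nhds_iff.1 (h1.and h2)
  filter_upwards [Ioo_mem_nhdsGT hr] with δ hδ a ha b hb hda hdb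
  have ha' := (hr' (y := a) (by rw [Real.dist_eq]; exact hda.trans_lt hδ.2)).1 ha
  have hb' := (hr' (y := b) (by rw [Real.dist_eq]; exact hdb.trans_lt hδ.2)).2
  linarith

lemma tendsto_of_rate {x : ℕ → ℝ} {γ : ℝ}
    (h : (fun n : ℕ => x n - γ) =O[atTop] (fun n : ℕ => 1 / (n : ℝ))) :
    Tendsto x atTop (𝓝 γ) := by
  have := (h.trans_tendsto tendsto_one_div_atTop_nhds_zero_nat).add_const γ
  simpa using this

lemma tendsto_index {g : ℕ → ℝ} {γ : ℝ} (hg : ∀ n, g n ∈ Icc (0 : ℝ) 1)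
    (h : Tendsto g atTop (𝓝 γ)) :
    Tendsto (fun m : ℕ => (lowerIndex m (g (m + 1)) : ℝ) / m) atTop (𝓝 γ) :=
  tendsto_lowerIndex_div (fun n => (hg (n + 1)).1) ((tendsto_add_atTop_iff_nat 1).2 h)

lemma exists_concentrationRadii {p : ℕ} (α γ : Fin p → ℝ) (γn : ℕ → Fin p → ℝ)
    (hα : ∀ i, 0 < α i) (hγ : ∀ i, γ i ∈ Icc (0 : ℝ) 1) (hγn : ∀ n i, γn n i ∈ Icc (0 : ℝ) 1)
    (hlim : ∀ i, Tendsto (fun n => γn n i) atTop (𝓝 (γ i))) :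
    ∃ δ : Fin p → ℝ, ConcentrationRadii (fun n => mixtureDistortion α (γn n) n) γ δ := by
  -- The bounds by `γ i` and `1 - γ i` keep `a` and `b` off the endpoints; if `γ i` is itself an
  -- endpoint, the side beyond it contains no points.
  have hex : ∀ i, ∃ δ : ℝ, 0 < δ ∧ (0 < γ i → δ < γ i) ∧ (γ i < 1 → δ < 1 - γ i) ∧
      ∀ j, γ j ≠ γ i → ∀ a ∈ Ioo (0 : ℝ) 1, ∀ b ∈ Ioo (0 : ℝ) 1, |a - γ i| ≤ δ → |b - γ i| ≤ δ →
        crossLog (γ j) a + Real.binEntropy (γ j) < crossLog (γ i) b + Real.binEntropy (γ i) := by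
    intro i
    have h0 : ∀ᶠ δ in 𝓝[>] (0 : ℝ), 0 < δ := eventually_mem_nhdsWithin
    have h1 : ∀ c : ℝ, ∀ᶠ δ in 𝓝[>] (0 : ℝ), 0 < c → δ < c := by
      intro c
      by_cases hc : 0 < c
      · filter_upwards [Ioo_mem_nhdsGT hc] with δ hδ _ using hδ.2
      · exact Eventually.of_forall fun _ h => absurd h hc
    have h2 : ∀ᶠ δ in 𝓝[>] (0 : ℝ), ∀ j, γ j ≠ γ i → ∀ a ∈ Ioo (0 : ℝ) 1, ∀ b ∈ Ioo (0 : ℝ) 1,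
        |a - γ i| ≤ δ → |b - γ i| ≤ δ →
        crossLog (γ j) a + Real.binEntropy (γ j) < crossLog (γ i) b + Real.binEntropy (γ i) := by
      rw [eventually_all]
      intro j
      by_cases hj : γ j = γ i
      · exact Eventually.of_forall fun _ h => absurd hj h
      · filter_upwards [eventually_divergence_lt (hγ i) (hγ j) hj] with δ hδ _ using hδ
    obtain ⟨δ, h0, h1, h1', h2⟩ := (h0.and ((h1 (γ i)).and ((h1 (1 - γ i)).and h2))).exists
    exact ⟨δ, h0, h1, fun h => h1' (sub_pos.2 h), h2⟩
  choose δ hδ0 hδl hδr hδ using hex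
  refine ⟨δ, fun i => ⟨hδ0 i, fun a ha b hb hab => ?_⟩⟩
  have hmem : a ∈ Ioo (0 : ℝ) 1 ∧ b ∈ Ioo (0 : ℝ) 1 ∧ |a - γ i| ≤ δ i ∧ |b - γ i| ≤ δ i := by
    rcases hab with ⟨h1, h2, h3⟩ | ⟨h1, h2, h3⟩
    · have := hδl i (ha.1.trans_lt (h2.trans h3))
      have := (hγ i).2
      refine ⟨⟨by linarith, by linarith⟩, ⟨by linarith, by linarith⟩, ?_, ?_⟩ <;>
        rw [abs_le] <;> constructor <;> linarith
    · have := hδr i ((h1.trans h2).trans_le ha.2)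
      have := (hγ i).1
      refine ⟨⟨by linarith, by linarith⟩, ⟨by linarith, by linarith⟩, ?_, ?_⟩ <;>
        rw [abs_le] <;> constructor <;> linarith
  obtain ⟨ha', hb', hda, hdb⟩ := hmem
  have hlt : ∀ j, crossLog (γ j) a + Real.binEntropy (γ j)
      < crossLog (γ i) b + Real.binEntropy (γ i) := by
    intro j
    by_cases hj : γ j = γ i
    · rw [hj]
      refine (add_lt_add_iff_right _).2 ?_
      rcases hab with ⟨h1, h2, h3⟩ | ⟨h1, h2, h3⟩
      · exact crossLog_lt_of_lt_of_le ha'.1 h2 h3.le hb'.2 (hγ i).2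
      · exact crossLog_lt_of_le_of_lt hb'.1 h1.le h2 ha'.2 (hγ i).1
    · exact hδ i j hj a ha' b hb' hda hdb
  have hidx : ∀ j, Tendsto (fun m : ℕ => (lowerIndex m (γn (m + 1) j) : ℝ) / m) atTop
      (𝓝 (γ j)) := fun j => tendsto_index (g := fun n => γn n j) (fun n => hγn n j) (hlim j)
  rw [← tendsto_add_atTop_iff_nat 1]
  simp only [fun m u => (hasDerivAt_mixtureDistortion α (fun i => (hγn (m + 1) i).2) m u).deriv]
  -- Keeping only the `i`-th term of the denominator dominates the quotient by finitely many ratios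
  -- of single densities.
  have hbound : Tendsto (fun m : ℕ => ∑ j, (α j / α i) *
      (orderDensity m (lowerIndex m (γn (m + 1) j)) a
        / orderDensity m (lowerIndex m (γn (m + 1) i)) b)) atTop (𝓝 0) := by
    rw [show (0 : ℝ) = ∑ j, (α j / α i) * 0 by simp]
    refine tendsto_finsetSum _ fun j _ => Tendsto.const_mul _ ?_
    exact tendsto_orderDensity_div (q := fun m => lowerIndex m (γn (m + 1) j))
      (r := fun m => lowerIndex m (γn (m + 1) i)) (fun m => lowerIndex_le m (hγn _ j).2)
      (fun m => lowerIndex_le m (hγn _ i).2) (hidx j)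
      (hidx i) ha' hb' (hlt j)
  refine squeeze_zero (fun m => ?_) (fun m => ?_) hbound
  · exact div_nonneg
      (Finset.sum_nonneg fun j _ => mul_nonneg (hα j).le (orderDensity_nonneg _ _ ha))
      (Finset.sum_nonneg fun j _ => mul_nonneg (hα j).le (orderDensity_nonneg _ _ hb))
  · have hpos := orderDensity_pos (lowerIndex_le m (hγn (m + 1) i).2) hb'
    have hle := mul_orderDensity_le_mixtureDensity hα (γn (m + 1)) m i hb
    rw [mixtureDensity, Finset.sum_div]
    refine Finset.sum_le_sum fun j _ => ?_
    rw [div_mul_div_comm]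
    exact div_le_div_of_nonneg_left (mul_nonneg (hα j).le (orderDensity_nonneg _ _ ha))
      (mul_pos (hα i) hpos) hle

/-! ### The mixture distortion as an increasing bijection of the unit interval -/

lemma mixtureDistortion_zero {p : ℕ} (α g : Fin p → ℝ) (n : ℕ) :
    mixtureDistortion α g n 0 = 0 := by
  simp [mixtureDistortion, distortion_zero]

lemma mixtureDistortion_one {p : ℕ} {α g : Fin p → ℝ} (hα : ∑ i, α i = 1) (hg : ∀ i, g i ≤ 1)
    (m : ℕ) : mixtureDistortion α g (m + 1) 1 = 1 := by
  simp [mixtureDistortion, fun i => distortion_one m (hg i), hα]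

lemma mixtureDensity_nonneg {p : ℕ} {α : Fin p → ℝ} (hα : ∀ i, 0 < α i) (g : Fin p → ℝ) (m : ℕ)
    {u : ℝ} (hu : u ∈ Icc (0 : ℝ) 1) : 0 ≤ mixtureDensity α g m u :=
  Finset.sum_nonneg fun j _ => mul_nonneg (hα j).le (orderDensity_nonneg _ _ hu)

lemma strictMonoOn_mixtureDistortion {p : ℕ} {α g : Fin p → ℝ} (hα : ∀ i, 0 < α i)
    (hα_sum : ∑ i, α i = 1) (hg : ∀ i, g i ≤ 1) (m : ℕ) :
    StrictMonoOn (mixtureDistortion α g (m + 1)) (Icc 0 1) := by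
  have hd := hasDerivAt_mixtureDistortion α hg m
  refine strictMonoOn_of_deriv_pos (convex_Icc 0 1)
    (fun u _ => (hd u).continuousAt.continuousWithinAt) fun u hu => ?_
  rw [interior_Icc] at hu
  rw [(hd u).deriv]
  have hp : (Finset.univ : Finset (Fin p)).Nonempty := by
    rw [Finset.nonempty_iff_ne_empty]
    intro h
    simp [h] at hα_sum
  exact Finset.sum_pos (fun j _ => mul_pos (hα j) (orderDensity_pos (lowerIndex_le m (hg j)) hu)) hp

/-! ### The law of an order statistic -/

lemma orderStat_le_iff {n k : ℕ} (hk : 1 ≤ k) (hkn : k ≤ n) (v : Fin n → ℝ) (x : ℝ) :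
    orderStat v k ≤ x ↔ k ≤ (Finset.univ.filter fun i => v i ≤ x).card := by
  have h : k - 1 < n := by omega
  rw [orderStat, dif_pos h]
  have h1 := Tuple.lt_card_le_iff_apply_le_of_monotone (j := ⟨k - 1, h⟩) (a := x)
    (Tuple.monotone_sort v)
  have h2 : (Finset.univ.filter fun i => (v ∘ Tuple.sort v) i ≤ x).card
      = (Finset.univ.filter fun i => v i ≤ x).card :=
    Finset.card_equiv (Tuple.sort v) (by simp)
  rw [h2] at h1
  have h3 : v (Tuple.sort v ⟨k - 1, h⟩) ≤ x ↔
    k - 1 < (Finset.univ.filter fun i => v i ≤ x).card := h1.symm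
  rw [h3]
  omega

lemma pi_real_filter_eq {n : ℕ} (μ : Measure ℝ) [IsProbabilityMeasure μ] (x : ℝ)
    (S : Finset (Fin n)) :
    (Measure.pi (fun _ : Fin n => μ)).real {v | (Finset.univ.filter fun i => v i ≤ x) = S}
      = cdf μ x ^ S.card * (1 - cdf μ x) ^ (n - S.card) := by
  classical
  have hset : {v : Fin n → ℝ | (Finset.univ.filter fun i => v i ≤ x) = S}
      = Set.pi univ (fun i => if i ∈ S then Iic x else (Iic x)ᶜ) := by
    ext v
    simp only [mem_ofPred_eq, Finset.ext_iff, Finset.mem_filter, Finset.mem_univ, true_and,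
      Set.mem_pi, mem_univ, forall_const]
    refine forall_congr' fun i => ?_
    by_cases hi : i ∈ S <;> simp [hi]
  have h1 : ∀ i : Fin n, (μ (if i ∈ S then Iic x else (Iic x)ᶜ)).toReal
      = if i ∈ S then cdf μ x else 1 - cdf μ x := by
    intro i
    split_ifs
    · rw [cdf_eq_real]; rfl
    · rw [cdf_eq_real, ← probReal_compl_eq_one_sub measurableSet_Iic]; rfl
  rw [hset, measureReal_def, Measure.pi_pi, ENNReal.toReal_prod]
  simp only [h1]
  rw [Finset.prod_ite]
  simp only [Finset.prod_const]
  congr 2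
  · simp
  · rw [Finset.filter_not, Finset.card_sdiff_of_subset (Finset.filter_subset _ _)]
    simp

/-- The cdf of an order statistic is the binomial tail at the cdf of the sample. -/
lemma orderStatCDF_eq {n k : ℕ} (hk : 1 ≤ k) (hkn : k ≤ n) (μ : Measure ℝ)
    [IsProbabilityMeasure μ] (x : ℝ) :
    orderStatCDF μ n k x = ∑ j ∈ Finset.Icc k n,
      (n.choose j : ℝ) * cdf μ x ^ j * (1 - cdf μ x) ^ (n - j) := by
  classical
  -- Split according to the set `S` of coordinates not exceeding `x`. Each probability depends only
  -- on the cardinality of `S`, so grouping by cardinality produces the binomial coefficients.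
  have hset : {v : Fin n → ℝ | orderStat v k ≤ x}
      = ⋃ S ∈ (Finset.univ : Finset (Finset (Fin n))).filter (fun S => k ≤ S.card),
        {v | (Finset.univ.filter fun i => v i ≤ x) = S} := by
    ext v
    simp [orderStat_le_iff hk hkn]
  have hmeas : ∀ S : Finset (Fin n),
      MeasurableSet {v : Fin n → ℝ | (Finset.univ.filter fun i => v i ≤ x) = S} := by
    intro S
    have : {v : Fin n → ℝ | (Finset.univ.filter fun i => v i ≤ x) = S}
        = ⋂ i, {v : Fin n → ℝ | v i ≤ x ↔ i ∈ S} := by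
      ext v
      simp [Finset.ext_iff]
    rw [this]
    refine MeasurableSet.iInter fun i => ?_
    have hi : MeasurableSet {v : Fin n → ℝ | v i ≤ x} :=
      measurableSet_le (measurable_pi_apply i) measurable_const
    by_cases h : i ∈ S
    · simpa [h] using hi
    · simpa [h, compl_ofPred] using hi.compl
  rw [orderStatCDF, hset, measureReal_biUnion_finset]
  · simp only [pi_real_filter_eq]
    rw [Finset.sum_filter, ← Finset.powerset_univ,
      Finset.sum_powerset_apply_card (fun j => if k ≤ j then
        cdf μ x ^ j * (1 - cdf μ x) ^ (n - j) else 0)]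
    simp only [Finset.card_univ, Fintype.card_fin, smul_ite, smul_zero, nsmul_eq_mul]
    rw [← Finset.sum_filter]
    have : (Finset.range (n + 1)).filter (fun j => k ≤ j) = Finset.Icc k n := by
      ext j
      simp only [Finset.mem_filter, Finset.mem_range, Finset.mem_Icc]
      omega
    rw [this]
    exact Finset.sum_congr rfl fun j _ => by ring
  · intro S _ T _ hST
    rw [Function.onFun, Set.disjoint_left]
    intro v hS hT
    exact hST (hS.symm.trans hT)
  · exact fun S _ => hmeas S

lemma mixtureCDF_eq {p : ℕ} (α : Fin p → ℝ) {g : Fin p → ℝ} (hg : ∀ i, g i ≤ 1) (μ : Measure ℝ)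
    [IsProbabilityMeasure μ] (m : ℕ) (x : ℝ) :
    mixtureCDF α g μ (m + 1) x = mixtureDistortion α g (m + 1) (cdf μ x) := by
  refine Finset.sum_congr rfl fun i _ => ?_
  have hle := lowerIndex_le m (hg i)
  rw [orderStatCDF_eq (by rw [rank_succ]; omega) (by rw [rank_succ]; omega), distortion]

/-! ### Quantiles of continuous strictly increasing cdfs -/

section Quantile

variable {μ ν : Measure ℝ}

lemma cdf_mem_Icc (μ : Measure ℝ) (x : ℝ) : cdf μ x ∈ Icc (0 : ℝ) 1 :=
  ⟨cdf_nonneg μ x, cdf_le_one μ x⟩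

lemma cdf_mem_Ioo (hm : StrictMono (cdf μ)) (x : ℝ) : cdf μ x ∈ Ioo (0 : ℝ) 1 :=
  ⟨(cdf_nonneg μ (x - 1)).trans_lt (hm (by linarith)),
    (hm (show x < x + 1 by linarith)).trans_le (cdf_le_one μ (x + 1))⟩

lemma exists_cdf_eq (hc : Continuous (cdf μ)) {u : ℝ} (hu : u ∈ Ioo (0 : ℝ) 1) :
    ∃ x, cdf μ x = u := by
  obtain ⟨a, ha⟩ := ((tendsto_cdf_atBot μ).eventually_lt_const hu.1).exists
  obtain ⟨b, hb⟩ := ((tendsto_cdf_atTop μ).eventually_const_lt hu.2).exists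
  exact mem_range_of_exists_le_of_exists_ge hc ⟨a, ha.le⟩ ⟨b, hb.le⟩

lemma quantileReal_cdf (hm : StrictMono (cdf μ)) (x : ℝ) :
    quantileReal (cdf μ) (cdf μ x) = x := by
  have h : quantile (cdf μ) (cdf μ x) = (x : EReal) := by
    refine IsLeast.csInf_eq ⟨⟨x, le_refl (cdf μ x), rfl⟩, ?_⟩
    rintro _ ⟨y, hy, rfl⟩
    exact EReal.coe_le_coe_iff.2 (hm.le_iff_le.1 hy)
  rw [quantileReal, h, EReal.toReal_coe]

lemma cdf_quantileReal (hc : Continuous (cdf μ)) (hm : StrictMono (cdf μ)) {u : ℝ}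
    (hu : u ∈ Ioo (0 : ℝ) 1) : cdf μ (quantileReal (cdf μ) u) = u := by
  obtain ⟨x, rfl⟩ := exists_cdf_eq hc hu
  rw [quantileReal_cdf hm]

lemma strictMonoOn_quantileReal (hc : Continuous (cdf μ)) (hm : StrictMono (cdf μ)) :
    StrictMonoOn (quantileReal (cdf μ)) (Ioo 0 1) := by
  intro u hu v hv huv
  rw [← hm.lt_iff_lt, cdf_quantileReal hc hm hu, cdf_quantileReal hc hm hv]
  exact huv

/-- A strictly increasing function with image all of `ℝ` has no jumps. -/
lemma continuousOn_quantileReal (hc : Continuous (cdf μ)) (hm : StrictMono (cdf μ)) :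
    ContinuousOn (quantileReal (cdf μ)) (Ioo 0 1) := by
  intro u hu
  refine ContinuousAt.continuousWithinAt ?_
  refine (strictMonoOn_quantileReal hc hm).continuousAt_of_image_mem_nhds
    (Ioo_mem_nhds hu.1 hu.2) ?_
  have : quantileReal (cdf μ) '' Ioo 0 1 = univ :=
    eq_univ_of_forall fun x => ⟨cdf μ x, cdf_mem_Ioo hm x, quantileReal_cdf hm x⟩
  rw [this]
  exact univ_mem

lemma aemeasurable_quantileReal (hc : Continuous (cdf μ)) (hm : StrictMono (cdf μ)) :
    AEMeasurable (quantileReal (cdf μ)) (volume.restrict (Ioo 0 1)) :=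
  (continuousOn_quantileReal hc hm).aemeasurable measurableSet_Ioo

/-- The quantile function transports the uniform law to `μ`. -/
lemma map_quantileReal [IsProbabilityMeasure μ] (hc : Continuous (cdf μ))
    (hm : StrictMono (cdf μ)) :
    (volume.restrict (Ioo (0 : ℝ) 1)).map (quantileReal (cdf μ)) = μ := by
  refine Measure.ext_of_Iic _ _ fun x => ?_
  rw [Measure.map_apply_of_aemeasurable (aemeasurable_quantileReal hc hm) measurableSet_Iic,
    Measure.restrict_apply₀' measurableSet_Ioo.nullMeasurableSet]
  have : quantileReal (cdf μ) ⁻¹' Iic x ∩ Ioo 0 1 = Ioc 0 (cdf μ x) := by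
    ext u
    simp only [mem_inter_iff, mem_preimage, mem_Iic, mem_Ioc]
    constructor
    · rintro ⟨h, hu⟩
      refine ⟨hu.1, ?_⟩
      rw [← cdf_quantileReal hc hm hu]
      exact hm.monotone h
    · rintro ⟨h0, h⟩
      have hu : u ∈ Ioo (0 : ℝ) 1 := ⟨h0, h.trans_lt (cdf_mem_Ioo hm x).2⟩
      refine ⟨?_, hu⟩
      rwa [← hm.le_iff_le, cdf_quantileReal hc hm hu]
  rw [this, Real.volume_Ioc, sub_zero, ofReal_cdf]

/-- The squared difference of the quantiles. -/
def quantileGap (F G : ℝ → ℝ) (u : ℝ) : ℝ≥0∞ :=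
  ENNReal.ofReal ((quantileReal F u - quantileReal G u) ^ 2)

/-- Transporting the uniform law to `μ` and `ν` makes both quantiles square integrable, and `(a -
b)² ≤ 2a² + 2b²`. -/
lemma lintegral_quantileGap_ne_top [IsProbabilityMeasure μ] [IsProbabilityMeasure ν]
    (hc : Continuous (cdf μ)) (hm : StrictMono (cdf μ)) (h2 : Integrable (fun x : ℝ => x ^ 2) μ)
    (hc' : Continuous (cdf ν)) (hm' : StrictMono (cdf ν))
    (h2' : Integrable (fun x : ℝ => x ^ 2) ν) :
    ∫⁻ u in Ioo (0 : ℝ) 1, quantileGap (cdf μ) (cdf ν) u ≠ ∞ := by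
  have hi : ∀ {μ : Measure ℝ} [IsProbabilityMeasure μ], Continuous (cdf μ) →
      StrictMono (cdf μ) → Integrable (fun x : ℝ => x ^ 2) μ →
      Integrable (fun u => quantileReal (cdf μ) u ^ 2) (volume.restrict (Ioo (0 : ℝ) 1)) := by
    intro μ _ hc hm h2
    rw [← map_quantileReal hc hm] at h2
    rw [integrable_map_measure (by fun_prop)
      (by rw [map_quantileReal hc hm] at *; exact aemeasurable_quantileReal hc hm)] at h2
    exact h2
  have hsum := ((hi hc hm h2).const_mul 2).add ((hi hc' hm' h2').const_mul 2)
  refine ne_top_of_le_ne_top hsum.lintegral_lt_top.ne (lintegral_mono fun u => ?_)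
  refine ENNReal.ofReal_le_ofReal ?_
  simp only [Pi.add_apply]
  nlinarith [sq_nonneg (quantileReal (cdf μ) u + quantileReal (cdf ν) u)]

/-- Applying `cdf ν` to `G⁻¹(F x) < x` gives `F x < G x`: the levels in `A₀` are the images under
`F` of the points in `B₀`. -/
lemma mem_setA0_cdf (hm : StrictMono (cdf μ)) (hc' : Continuous (cdf ν))
    (hm' : StrictMono (cdf ν)) (x : ℝ) :
    cdf μ x ∈ setA0 (cdf μ) (cdf ν) ↔ cdf μ x < cdf ν x := by
  have hx := cdf_mem_Ioo hm x
  have h : cdf μ x ∈ setA0 (cdf μ) (cdf ν) ↔ quantileReal (cdf ν) (cdf μ x) < x := by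
    rw [setA0, mem_ofPred_eq, quantileReal_cdf hm]
    exact and_iff_right hx
  rw [h, ← hm'.lt_iff_lt, cdf_quantileReal hc' hm' hx]

lemma mem_setA2_cdf (hm : StrictMono (cdf μ)) (hc' : Continuous (cdf ν))
    (hm' : StrictMono (cdf ν)) (x : ℝ) :
    cdf μ x ∈ setA2 (cdf μ) (cdf ν) ↔ cdf μ x ≠ cdf ν x := by
  have hx := cdf_mem_Ioo hm x
  have h : cdf μ x ∈ setA2 (cdf μ) (cdf ν) ↔ x ≠ quantileReal (cdf ν) (cdf μ x) := by
    rw [setA2, mem_ofPred_eq, quantileReal_cdf hm]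
    exact and_iff_right hx
  rw [h, ← hm'.injective.ne_iff, cdf_quantileReal hc' hm' hx, ne_comm]

lemma isOpen_setA0 (hc : Continuous (cdf μ)) (hm : StrictMono (cdf μ)) (hc' : Continuous (cdf ν))
    (hm' : StrictMono (cdf ν)) : IsOpen (setA0 (cdf μ) (cdf ν)) := by
  have h := ((continuousOn_quantileReal hc hm).sub
    (continuousOn_quantileReal hc' hm')).isOpen_inter_preimage isOpen_Ioo (isOpen_Ioi (a := (0 : ℝ)))
  convert h using 1
  ext u
  simp [setA0]

lemma isOpen_setA2 (hc : Continuous (cdf μ)) (hm : StrictMono (cdf μ)) (hc' : Continuous (cdf ν))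
    (hm' : StrictMono (cdf ν)) : IsOpen (setA2 (cdf μ) (cdf ν)) := by
  have h := ((continuousOn_quantileReal hc hm).sub
    (continuousOn_quantileReal hc' hm')).isOpen_inter_preimage isOpen_Ioo
      (isOpen_compl_singleton (x := (0 : ℝ)))
  convert h using 1
  ext u
  simp [setA2, sub_eq_zero]

lemma aemeasurable_quantileGap (hc : Continuous (cdf μ)) (hm : StrictMono (cdf μ))
    (hc' : Continuous (cdf ν)) (hm' : StrictMono (cdf ν)) :
    AEMeasurable (quantileGap (cdf μ) (cdf ν)) (volume.restrict (Ioo 0 1)) :=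
  (((aemeasurable_quantileReal hc hm).sub (aemeasurable_quantileReal hc' hm')).pow_const
    2).ennreal_ofReal

lemma lintegral_quantileGap_ne_zero (hc : Continuous (cdf μ)) (hm : StrictMono (cdf μ))
    (hc' : Continuous (cdf ν)) (hm' : StrictMono (cdf ν)) {a b : ℝ} (hab : a < b)
    (hsub : Ioo a b ⊆ setA2 (cdf μ) (cdf ν)) :
    ∫⁻ u in Ioo a b, quantileGap (cdf μ) (cdf ν) u ≠ 0 := by
  have hsub' : Ioo a b ⊆ Ioo 0 1 := fun u hu => (hsub hu).1
  have hae := (aemeasurable_quantileGap hc hm hc' hm').mono_set hsub'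
  intro h
  rw [lintegral_eq_zero_iff' hae, Filter.EventuallyEq,
    ae_restrict_iff' measurableSet_Ioo] at h
  have hz : volume (Ioo a b) = 0 := by
    refine measure_mono_null (fun u hu => ?_) h
    intro hzero
    have h1 := hzero hu
    have h2 : quantileReal (cdf μ) u - quantileReal (cdf ν) u ≠ 0 := sub_ne_zero.2 (hsub hu).2
    rw [quantileGap, Pi.zero_apply, ENNReal.ofReal_eq_zero] at h1
    have : 0 < (quantileReal (cdf μ) u - quantileReal (cdf ν) u) ^ 2 := by positivity
    linarith
  rw [Real.volume_Ioo, ENNReal.ofReal_eq_zero] at hz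
  linarith

end Quantile

/-! ### Change of variables along a distortion -/

section Distortion

variable {F G φ φ' : ℝ → ℝ}

/-- Strict monotonicity makes `φ v ≤ φ (F x)` and `v ≤ F x` define the same set of `x`, hence the
same infimum. -/
lemma quantileReal_comp (hφ : StrictMonoOn φ (Icc 0 1)) (hF : ∀ x, F x ∈ Icc (0 : ℝ) 1) {v : ℝ}
    (hv : v ∈ Icc (0 : ℝ) 1) : quantileReal (fun x => φ (F x)) (φ v) = quantileReal F v := by
  simp only [quantileReal, quantile, hφ.le_iff_le hv (hF _)]

lemma image_Ioo_eq (hφ : StrictMonoOn φ (Icc 0 1)) (hc : ContinuousOn φ (Icc 0 1))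
    (h0 : φ 0 = 0) (h1 : φ 1 = 1) : φ '' Ioo 0 1 = Ioo 0 1 := by
  refine Subset.antisymm ?_ ?_
  · rintro _ ⟨v, hv, rfl⟩
    have e0 := hφ (left_mem_Icc.2 zero_le_one) (Ioo_subset_Icc_self hv) hv.1
    have e1 := hφ (Ioo_subset_Icc_self hv) (right_mem_Icc.2 zero_le_one) hv.2
    rw [h0] at e0
    rw [h1] at e1
    exact ⟨e0, e1⟩
  · have := intermediate_value_Ioo zero_le_one hc
    rwa [h0, h1] at this

lemma setA0_comp (hφ : StrictMonoOn φ (Icc 0 1)) (hc : ContinuousOn φ (Icc 0 1))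
    (h0 : φ 0 = 0) (h1 : φ 1 = 1) (hF : ∀ x, F x ∈ Icc (0 : ℝ) 1)
    (hG : ∀ x, G x ∈ Icc (0 : ℝ) 1) :
    setA0 (fun x => φ (F x)) (fun x => φ (G x)) = φ '' setA0 F G := by
  have him := image_Ioo_eq hφ hc h0 h1
  ext u
  constructor
  · rintro ⟨hu, hlt⟩
    rw [← him] at hu
    obtain ⟨v, hv, rfl⟩ := hu
    rw [quantileReal_comp hφ hF (Ioo_subset_Icc_self hv),
      quantileReal_comp hφ hG (Ioo_subset_Icc_self hv)] at hlt
    exact ⟨v, ⟨hv, hlt⟩, rfl⟩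
  · rintro ⟨v, ⟨hv, hlt⟩, rfl⟩
    refine ⟨him ▸ mem_image_of_mem φ hv, ?_⟩
    rwa [quantileReal_comp hφ hF (Ioo_subset_Icc_self hv),
      quantileReal_comp hφ hG (Ioo_subset_Icc_self hv)]

lemma lintegral_image_quantileGap (hφ : StrictMonoOn φ (Icc 0 1))
    (hd : ∀ u, HasDerivAt φ (φ' u) u) (hφ' : ∀ u ∈ Icc (0 : ℝ) 1, 0 ≤ φ' u)
    (hF : ∀ x, F x ∈ Icc (0 : ℝ) 1) (hG : ∀ x, G x ∈ Icc (0 : ℝ) 1)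
    {s : Set ℝ} (hs : MeasurableSet s) (hs' : s ⊆ Ioo 0 1) :
    ∫⁻ u in φ '' s, quantileGap (fun x => φ (F x)) (fun x => φ (G x)) u
      = ∫⁻ v in s, ENNReal.ofReal (φ' v) * quantileGap F G v := by
  have hs'' : s ⊆ Icc 0 1 := hs'.trans Ioo_subset_Icc_self
  rw [lintegral_image_eq_lintegral_abs_deriv_mul hs (fun x _ => (hd x).hasDerivWithinAt)
    (hφ.mono hs'').injOn]
  refine setLIntegral_congr_fun hs fun v hv => ?_
  simp only [quantileGap]
  rw [abs_of_nonneg (hφ' v (hs'' hv)), quantileReal_comp hφ hF (hs'' hv),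
    quantileReal_comp hφ hG (hs'' hv)]

lemma violation_comp (hφ : StrictMonoOn φ (Icc 0 1))
    (hd : ∀ u, HasDerivAt φ (φ' u) u) (hφ' : ∀ u ∈ Icc (0 : ℝ) 1, 0 ≤ φ' u)
    (h0 : φ 0 = 0) (h1 : φ 1 = 1)
    (hF : ∀ x, F x ∈ Icc (0 : ℝ) 1) (hG : ∀ x, G x ∈ Icc (0 : ℝ) 1)
    (hA : MeasurableSet (setA0 F G)) :
    violation (fun x => φ (F x)) (fun x => φ (G x))
      = ∫⁻ v in setA0 F G, ENNReal.ofReal (φ' v) * quantileGap F G v := by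
  rw [violation, setA0_comp hφ (fun u _ => (hd u).continuousAt.continuousWithinAt) h0 h1 hF hG]
  exact lintegral_image_quantileGap hφ hd hφ' hF hG hA fun u hu => hu.1

lemma wasserstein2_sq (F G : ℝ → ℝ) :
    wasserstein2 F G ^ 2 = ∫⁻ u in Ioo (0 : ℝ) 1, quantileGap F G u := by
  rw [wasserstein2, ← ENNReal.rpow_natCast, ← ENNReal.rpow_mul]
  norm_num
  rfl

lemma wasserstein2_comp_sq (hφ : StrictMonoOn φ (Icc 0 1))
    (hd : ∀ u, HasDerivAt φ (φ' u) u) (hφ' : ∀ u ∈ Icc (0 : ℝ) 1, 0 ≤ φ' u)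
    (h0 : φ 0 = 0) (h1 : φ 1 = 1)
    (hF : ∀ x, F x ∈ Icc (0 : ℝ) 1) (hG : ∀ x, G x ∈ Icc (0 : ℝ) 1) :
    wasserstein2 (fun x => φ (F x)) (fun x => φ (G x)) ^ 2
      = ∫⁻ v in Ioo (0 : ℝ) 1, ENNReal.ofReal (φ' v) * quantileGap F G v := by
  rw [wasserstein2_sq, ← lintegral_image_quantileGap hφ hd hφ' hF hG measurableSet_Ioo subset_rfl,
    image_Ioo_eq hφ (fun u _ => (hd u).continuousAt.continuousWithinAt) h0 h1]

lemma departure_le {ε : ℝ≥0∞} (hfin : violation F G ≠ ∞)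
    (h : violation F G ≤ ε * wasserstein2 F G ^ 2) : departure F G ≤ ε := by
  rw [departure]
  split_ifs
  · exact zero_le
  · exact ENNReal.div_le_of_le_mul h

end Distortion

/-! ### Conditions (A1) and (A2) in terms of levels -/

section Separation

variable {μ ν : Measure ℝ}

/-- This form also covers `γ = 0` and `γ = 1`, where the quantile is infinite. Strictness comes from
continuity, which leaves room for a point `y > x` still below level `γ`. -/
lemma coe_lt_quantile_iff (hc : Continuous (cdf μ)) (hm : StrictMono (cdf μ)) {x γ : ℝ} :
    (x : EReal) < quantile (cdf μ) γ ↔ cdf μ x < γ := by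
  constructor
  · intro h
    by_contra! hx
    exact absurd h (not_lt.2 (sInf_le ⟨x, hx, rfl⟩))
  · intro h
    have h1 : ∀ᶠ y in 𝓝[>] x, cdf μ y < γ :=
      (hc.continuousAt.eventually_lt_const h).filter_mono nhdsWithin_le_nhds
    obtain ⟨y, hy, hxy⟩ := (h1.and eventually_mem_nhdsWithin).exists
    refine (EReal.coe_lt_coe_iff.2 hxy).trans_le (le_sInf ?_)
    rintro _ ⟨z, hz, rfl⟩
    exact EReal.coe_le_coe_iff.2 (hm.lt_iff_lt.1 (hy.trans_le hz)).le

lemma quantile_lt_coe_iff (hc : Continuous (cdf μ)) (hm : StrictMono (cdf μ)) {x γ : ℝ} :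
    quantile (cdf μ) γ < (x : EReal) ↔ γ < cdf μ x := by
  constructor
  · intro h
    obtain ⟨_, ⟨y, hy, rfl⟩, hyx⟩ := sInf_lt_iff.1 h
    exact lt_of_le_of_lt hy (hm (EReal.coe_lt_coe_iff.1 hyx))
  · intro h
    have h1 : ∀ᶠ y in 𝓝[<] x, γ < cdf μ y :=
      (hc.continuousAt.eventually_const_lt h).filter_mono nhdsWithin_le_nhds
    obtain ⟨y, hy, hxy⟩ := (h1.and eventually_mem_nhdsWithin).exists
    exact lt_of_le_of_lt (sInf_le ⟨y, hy.le, rfl⟩) (EReal.coe_lt_coe_iff.2 hxy)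

lemma extendCDF_coe (F : ℝ → ℝ) (x : ℝ) : extendCDF F (x : EReal) = F x := by
  simp [extendCDF]

lemma extendCDF_bot (F : ℝ → ℝ) : extendCDF F ⊥ = 0 := by simp [extendCDF]

lemma extendCDF_top (F : ℝ → ℝ) : extendCDF F ⊤ = 1 := by simp [extendCDF]

lemma cdf_le_extendCDF {x : ℝ} {z : EReal} (h : (x : EReal) ≤ z) :
    cdf μ x ≤ extendCDF (cdf μ) z := by
  induction z using EReal.rec with
  | bot => exact absurd h (not_le.2 (EReal.bot_lt_coe x))
  | coe y => rw [extendCDF_coe]; exact monotone_cdf μ (EReal.coe_le_coe_iff.1 h)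
  | top => rw [extendCDF_top]; exact cdf_le_one μ x

lemma extendCDF_le_cdf {x : ℝ} {z : EReal} (h : z ≤ (x : EReal)) :
    extendCDF (cdf μ) z ≤ cdf μ x := by
  induction z using EReal.rec with
  | bot => rw [extendCDF_bot]; exact cdf_nonneg μ x
  | coe y => rw [extendCDF_coe]; exact monotone_cdf μ (EReal.coe_le_coe_iff.1 h)
  | top => exact absurd h (not_le.2 (EReal.coe_lt_top x))

lemma exists_lt_of_lt_extendCDF (hc : Continuous (cdf μ)) {c : ℝ} (h0 : 0 ≤ c) {z : EReal}
    (h : c < extendCDF (cdf μ) z) : ∃ x : ℝ, (x : EReal) < z ∧ c < cdf μ x := by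
  induction z using EReal.rec with
  | bot => rw [extendCDF_bot] at h; linarith
  | coe y =>
    rw [extendCDF_coe] at h
    have h1 : ∀ᶠ x in 𝓝[<] y, c < cdf μ x :=
      (hc.continuousAt.eventually_const_lt h).filter_mono nhdsWithin_le_nhds
    obtain ⟨x, hx, hxy⟩ := (h1.and eventually_mem_nhdsWithin).exists
    exact ⟨x, EReal.coe_lt_coe_iff.2 hxy, hx⟩
  | top =>
    rw [extendCDF_top] at h
    obtain ⟨x, hx⟩ := ((tendsto_cdf_atTop μ).eventually_const_lt h).exists
    exact ⟨x, EReal.coe_lt_top x, hx⟩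

lemma exists_gt_of_extendCDF_lt (hc : Continuous (cdf μ)) {c : ℝ} (h1 : c ≤ 1) {z : EReal}
    (h : extendCDF (cdf μ) z < c) : ∃ x : ℝ, z < (x : EReal) ∧ cdf μ x < c := by
  induction z using EReal.rec with
  | bot =>
    rw [extendCDF_bot] at h
    obtain ⟨x, hx⟩ := ((tendsto_cdf_atBot μ).eventually_lt_const h).exists
    exact ⟨x, EReal.bot_lt_coe x, hx⟩
  | coe y =>
    rw [extendCDF_coe] at h
    have h1 : ∀ᶠ x in 𝓝[>] y, cdf μ x < c :=
      (hc.continuousAt.eventually_lt_const h).filter_mono nhdsWithin_le_nhds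
    obtain ⟨x, hx, hxy⟩ := (h1.and eventually_mem_nhdsWithin).exists
    exact ⟨x, EReal.coe_lt_coe_iff.2 hxy, hx⟩
  | top => rw [extendCDF_top] at h; linarith

lemma le_extendCDF_pointC (hc : Continuous (cdf μ)) (hm : StrictMono (cdf μ))
    (hc' : Continuous (cdf ν)) (hm' : StrictMono (cdf ν)) {γ v : ℝ}
    (hv : v ∈ setA0 (cdf μ) (cdf ν)) (hvγ : v < γ) :
    v ≤ extendCDF (cdf μ) (pointC (cdf μ) (cdf ν) γ) := by
  obtain ⟨x, rfl⟩ := exists_cdf_eq hc hv.1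
  exact cdf_le_extendCDF (le_sSup ⟨x, ⟨(mem_setA0_cdf hm hc' hm' x).1 hv,
    (coe_lt_quantile_iff hc hm).2 hvγ⟩, rfl⟩)

lemma extendCDF_pointD_le (hc : Continuous (cdf μ)) (hm : StrictMono (cdf μ))
    (hc' : Continuous (cdf ν)) (hm' : StrictMono (cdf ν)) {γ v : ℝ}
    (hv : v ∈ setA0 (cdf μ) (cdf ν)) (hvγ : γ < v) :
    extendCDF (cdf μ) (pointD (cdf μ) (cdf ν) γ) ≤ v := by
  obtain ⟨x, rfl⟩ := exists_cdf_eq hc hv.1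
  exact extendCDF_le_cdf (sInf_le ⟨x, ⟨(mem_setA0_cdf hm hc' hm' x).1 hv,
    (quantile_lt_coe_iff hc hm).2 hvγ⟩, rfl⟩)

/-- The supremum defining `a_γ` need not be finite or attained. A real point strictly below it and
above level `c` is chosen first, and a point of `B₂` beyond that one then exists. -/
lemma exists_mem_setA2_gt (hc : Continuous (cdf μ)) (hm : StrictMono (cdf μ))
    (hc' : Continuous (cdf ν)) (hm' : StrictMono (cdf ν)) {γ c : ℝ} (h0 : 0 ≤ c)
    (h : c < extendCDF (cdf μ) (pointA (cdf μ) (cdf ν) γ)) :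
    ∃ u ∈ setA2 (cdf μ) (cdf ν), c < u ∧ u < γ := by
  obtain ⟨x, hx, hcx⟩ := exists_lt_of_lt_extendCDF hc h0 h
  obtain ⟨_, ⟨y, ⟨hy, hyγ⟩, rfl⟩, hxy⟩ := lt_sSup_iff.1 hx
  exact ⟨cdf μ y, (mem_setA2_cdf hm hc' hm' y).2 hy, hcx.trans (hm (EReal.coe_lt_coe_iff.1 hxy)),
    (coe_lt_quantile_iff hc hm).1 hyγ⟩

lemma exists_mem_setA2_lt (hc : Continuous (cdf μ)) (hm : StrictMono (cdf μ))
    (hc' : Continuous (cdf ν)) (hm' : StrictMono (cdf ν)) {γ d : ℝ} (h1 : d ≤ 1)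
    (h : extendCDF (cdf μ) (pointB (cdf μ) (cdf ν) γ) < d) :
    ∃ u ∈ setA2 (cdf μ) (cdf ν), γ < u ∧ u < d := by
  obtain ⟨x, hx, hcx⟩ := exists_gt_of_extendCDF_lt hc h1 h
  obtain ⟨_, ⟨y, ⟨hy, hyγ⟩, rfl⟩, hxy⟩ := sInf_lt_iff.1 hx
  exact ⟨cdf μ y, (mem_setA2_cdf hm hc' hm' y).2 hy, (quantile_lt_coe_iff hc hm).1 hyγ,
    (hm (EReal.coe_lt_coe_iff.1 hxy)).trans hcx⟩

lemma setA0_subset_setA2 (F G : ℝ → ℝ) : setA0 F G ⊆ setA2 F G := fun _ hu => ⟨hu.1, hu.2.ne'⟩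

end Separation

/-! ### Negligible sets of levels -/

/-- The densities `T m` give asymptotically negligible relative weight to `S` within `(0,1)`. -/
def NegligibleOn (T : ℕ → ℝ → ℝ) (w : ℝ → ℝ≥0∞) (S : Set ℝ) : Prop :=
  ∀ ε : ℝ≥0∞, 0 < ε → ∀ᶠ m in atTop,
    ∫⁻ v in S, ENNReal.ofReal (T m v) * w v
      ≤ ε * ∫⁻ v in Ioo (0 : ℝ) 1, ENNReal.ofReal (T m v) * w v

lemma NegligibleOn.union {T : ℕ → ℝ → ℝ} {w : ℝ → ℝ≥0∞} {S S' : Set ℝ}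
    (h : NegligibleOn T w S) (h' : NegligibleOn T w S') : NegligibleOn T w (S ∪ S') := by
  intro ε hε
  have hε' : 0 < ε / 2 := ENNReal.half_pos hε.ne'
  filter_upwards [h _ hε', h' _ hε'] with m h1 h2
  refine (lintegral_union_le _ _ _).trans ((add_le_add h1 h2).trans ?_)
  rw [← add_mul, ENNReal.add_halves]

lemma NegligibleOn.mono {T : ℕ → ℝ → ℝ} {w : ℝ → ℝ≥0∞} {S S' : Set ℝ}
    (h : NegligibleOn T w S') (hS : S ⊆ S') : NegligibleOn T w S := fun ε hε =>
  (h ε hε).mono fun _ hm => (lintegral_mono_set hS).trans hm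

lemma negligibleOn_of_null {T : ℕ → ℝ → ℝ} {w : ℝ → ℝ≥0∞} {S : Set ℝ} (hS : volume S = 0) :
    NegligibleOn T w S := fun ε _ => Eventually.of_forall fun m => by
  rw [setLIntegral_measure_zero _ _ hS]
  exact zero_le

/-- A set on which `T m` stays below `T m c` is negligible if `T m` exceeds `T m u` on a set of
positive weight and `T m c / T m u → 0`. -/
lemma negligibleOn_of_ratio {T : ℕ → ℝ → ℝ} {w : ℝ → ℝ≥0∞} {S U : Set ℝ} {c u : ℝ}
    (hS : S ⊆ Ioo 0 1) (hSm : MeasurableSet S) (hU : U ⊆ Ioo 0 1) (hUm : MeasurableSet U)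
    (hw : ∫⁻ v in Ioo (0 : ℝ) 1, w v ≠ ∞) (hw0 : ∫⁻ v in U, w v ≠ 0)
    (hpos : ∀ m, 0 < T m u)
    (hlim : Tendsto (fun m => T m c / T m u) atTop (𝓝 0))
    (hTS : ∀ᶠ m in atTop, ∀ v ∈ S, T m v ≤ T m c)
    (hTU : ∀ᶠ m in atTop, ∀ v ∈ U, T m u ≤ T m v) :
    NegligibleOn T w S := by
  intro ε hε
  set K := ∫⁻ v in U, w v
  set C := ∫⁻ v in Ioo (0 : ℝ) 1, w v
  have hK : K ≠ ∞ := ne_top_of_le_ne_top hw (lintegral_mono_set hU)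
  -- The integral over `S` is at most `T m c * C` and the one over `(0,1)` at least `T m u * K`;
  -- finiteness of `C` and `K ≠ 0` keep `C / K` harmless.
  have hr : Tendsto (fun m => ENNReal.ofReal (T m c / T m u) * (C / K)) atTop (𝓝 0) := by
    have h1 : Tendsto (fun m => ENNReal.ofReal (T m c / T m u)) atTop (𝓝 0) := by
      simpa using ENNReal.tendsto_ofReal hlim
    have h2 := ENNReal.Tendsto.mul_const h1 (Or.inr (ENNReal.div_ne_top hw hw0))
    rwa [zero_mul] at h2
  filter_upwards [ENNReal.tendsto_nhds_zero.1 hr ε hε, hTS, hTU] with m hm h1 h2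
  have hupper : ∫⁻ v in S, ENNReal.ofReal (T m v) * w v ≤ ENNReal.ofReal (T m c) * C := by
    calc ∫⁻ v in S, ENNReal.ofReal (T m v) * w v
        ≤ ∫⁻ v in S, ENNReal.ofReal (T m c) * w v :=
          setLIntegral_mono' hSm fun v hv => by gcongr; exact h1 v hv
      _ = ENNReal.ofReal (T m c) * ∫⁻ v in S, w v :=
          lintegral_const_mul' _ _ ENNReal.ofReal_ne_top
      _ ≤ ENNReal.ofReal (T m c) * C := by gcongr; exact lintegral_mono_set hS
  have hlower : ENNReal.ofReal (T m u) * K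
      ≤ ∫⁻ v in Ioo (0 : ℝ) 1, ENNReal.ofReal (T m v) * w v := by
    calc ENNReal.ofReal (T m u) * K
        = ∫⁻ v in U, ENNReal.ofReal (T m u) * w v :=
          (lintegral_const_mul' _ _ ENNReal.ofReal_ne_top).symm
      _ ≤ ∫⁻ v in U, ENNReal.ofReal (T m v) * w v :=
          setLIntegral_mono' hUm fun v hv => by gcongr; exact h2 v hv
      _ ≤ _ := lintegral_mono_set hU
  have hT0 : ENNReal.ofReal (T m u) ≠ 0 := (ENNReal.ofReal_pos.2 (hpos m)).ne'
  calc ∫⁻ v in S, ENNReal.ofReal (T m v) * w v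
      ≤ ENNReal.ofReal (T m c) * C := hupper
    _ = ENNReal.ofReal (T m c / T m u) * (C / K) * (ENNReal.ofReal (T m u) * K) := by
        rw [mul_mul_mul_comm, ENNReal.div_mul_cancel hw0 hK, ENNReal.ofReal_div_of_pos (hpos m),
          ENNReal.div_mul_cancel hT0 ENNReal.ofReal_ne_top]
    _ ≤ ε * ∫⁻ v in Ioo (0 : ℝ) 1, ENNReal.ofReal (T m v) * w v := mul_le_mul' hm hlower

section

variable {μ ν : Measure ℝ} {q : ℕ → ℕ} {γ : ℝ}

/-- All of `A₀` below `γ` lies at or below `c = F(c_γ)`, whereas some interval of `A₂` sits strictly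
between `c` and `γ`. The density increases up to its mode near `γ`, and its value at `c` is
exponentially smaller than on that interval. -/
lemma negligibleOn_left (hc : Continuous (cdf μ)) (hm : StrictMono (cdf μ))
    (hc' : Continuous (cdf ν)) (hm' : StrictMono (cdf ν))
    (hw : ∫⁻ v in Ioo (0 : ℝ) 1, quantileGap (cdf μ) (cdf ν) v ≠ ∞)
    (hq : ∀ m, q m ≤ m) (hγ : γ ≤ 1) (hlim : Tendsto (fun m : ℕ => (q m : ℝ) / m) atTop (𝓝 γ))
    (hcond : (setA2 (cdf μ) (cdf ν) ∩ Ioo 0 γ).Nonempty →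
      extendCDF (cdf μ) (pointC (cdf μ) (cdf ν) γ)
        < extendCDF (cdf μ) (pointA (cdf μ) (cdf ν) γ)) :
    NegligibleOn (fun m => orderDensity m (q m)) (quantileGap (cdf μ) (cdf ν))
      (setA0 (cdf μ) (cdf ν) ∩ Iio γ) := by
  rcases (setA0 (cdf μ) (cdf ν) ∩ Iio γ).eq_empty_or_nonempty with hE | ⟨v, hv, hvγ⟩
  · rw [hE]; exact negligibleOn_of_null measure_empty
  set c := extendCDF (cdf μ) (pointC (cdf μ) (cdf ν) γ)
  have hvc : v ≤ c := le_extendCDF_pointC hc hm hc' hm' hv hvγ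
  have hc0 : 0 < c := hv.1.1.trans_le hvc
  obtain ⟨u, hu, hcu, huγ⟩ := exists_mem_setA2_gt hc hm hc' hm' hc0.le
    (hcond ⟨v, setA0_subset_setA2 _ _ hv, hv.1.1, hvγ⟩)
  have hc1 : c < 1 := hcu.trans hu.1.2
  obtain ⟨r, hr, hball⟩ := Metric.isOpen_iff.1
    ((isOpen_setA2 hc hm hc' hm').inter isOpen_Ioo) u ⟨hu, hcu, huγ⟩
  rw [Real.ball_eq_Ioo] at hball
  have hb : ∀ w, u - r < w → w < u + r → w ∈ setA2 (cdf μ) (cdf ν) ∩ Ioo c γ :=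
    fun w h1 h2 => hball ⟨h1, h2⟩
  -- Halving the radius puts both endpoints strictly inside: the left one is the comparison level,
  -- and the right one is eventually below the mode `q m / m`.
  have ha := hb (u - r / 2) (by linarith) (by linarith)
  have hd := hb (u + r / 2) (by linarith) (by linarith)
  have hsub : Ioo (u - r / 2) (u + r / 2) ⊆ setA2 (cdf μ) (cdf ν) :=
    fun w hw => (hb w (by linarith [hw.1]) (by linarith [hw.2])).1
  refine negligibleOn_of_ratio (c := c) (u := u - r / 2) (fun w hw => hw.1.1)
    ((isOpen_setA0 hc hm hc' hm').inter isOpen_Iio).measurableSet (fun w hw => (hsub hw).1)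
    measurableSet_Ioo hw
    (lintegral_quantileGap_ne_zero hc hm hc' hm' (by linarith) hsub)
    (fun m => orderDensity_pos (hq m) ha.1.1) ?_ ?_ ?_
  · refine tendsto_orderDensity_div hq hq hlim hlim ⟨hc0, hc1⟩ ha.1.1 ?_
    exact (add_lt_add_iff_right _).2
      (crossLog_lt_of_lt_of_le hc0 ha.2.1 ha.2.2.le ha.1.1.2 hγ)
  · filter_upwards [hlim.eventually_const_lt (hcu.trans huγ), eventually_gt_atTop 0]
      with m hm1 hm0 w hw
    exact orderDensity_le_of_le_left hm0 (hq m) hw.1.1.1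
      (le_extendCDF_pointC hc hm hc' hm' hw.1 hw.2) hc1 hm1.le
  · filter_upwards [hlim.eventually_const_lt hd.2.2, eventually_gt_atTop 0] with m hm1 hm0 w hw
    exact orderDensity_le_of_le_left hm0 (hq m) ha.1.1.1 hw.1.le (hsub hw).1.2 (hw.2.trans hm1).le

lemma negligibleOn_right (hc : Continuous (cdf μ)) (hm : StrictMono (cdf μ))
    (hc' : Continuous (cdf ν)) (hm' : StrictMono (cdf ν))
    (hw : ∫⁻ v in Ioo (0 : ℝ) 1, quantileGap (cdf μ) (cdf ν) v ≠ ∞)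
    (hq : ∀ m, q m ≤ m) (hγ : 0 ≤ γ) (hlim : Tendsto (fun m : ℕ => (q m : ℝ) / m) atTop (𝓝 γ))
    (hcond : (setA2 (cdf μ) (cdf ν) ∩ Ioo γ 1).Nonempty →
      extendCDF (cdf μ) (pointB (cdf μ) (cdf ν) γ)
        < extendCDF (cdf μ) (pointD (cdf μ) (cdf ν) γ)) :
    NegligibleOn (fun m => orderDensity m (q m)) (quantileGap (cdf μ) (cdf ν))
      (setA0 (cdf μ) (cdf ν) ∩ Ioi γ) := by
  rcases (setA0 (cdf μ) (cdf ν) ∩ Ioi γ).eq_empty_or_nonempty with hE | ⟨v, hv, hvγ⟩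
  · rw [hE]; exact negligibleOn_of_null measure_empty
  set c := extendCDF (cdf μ) (pointD (cdf μ) (cdf ν) γ)
  have hvc : c ≤ v := extendCDF_pointD_le hc hm hc' hm' hv hvγ
  have hc1 : c < 1 := hvc.trans_lt hv.1.2
  obtain ⟨u, hu, huγ, hcu⟩ := exists_mem_setA2_lt hc hm hc' hm' hc1.le
    (hcond ⟨v, setA0_subset_setA2 _ _ hv, hvγ, hv.1.2⟩)
  have hc0 : 0 < c := hu.1.1.trans hcu
  obtain ⟨r, hr, hball⟩ := Metric.isOpen_iff.1
    ((isOpen_setA2 hc hm hc' hm').inter isOpen_Ioo) u ⟨hu, huγ, hcu⟩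
  rw [Real.ball_eq_Ioo] at hball
  have hb : ∀ w, u - r < w → w < u + r → w ∈ setA2 (cdf μ) (cdf ν) ∩ Ioo γ c :=
    fun w h1 h2 => hball ⟨h1, h2⟩
  have ha := hb (u - r / 2) (by linarith) (by linarith)
  have hd := hb (u + r / 2) (by linarith) (by linarith)
  have hsub : Ioo (u - r / 2) (u + r / 2) ⊆ setA2 (cdf μ) (cdf ν) :=
    fun w hw => (hb w (by linarith [hw.1]) (by linarith [hw.2])).1
  refine negligibleOn_of_ratio (c := c) (u := u + r / 2) (fun w hw => hw.1.1)
    ((isOpen_setA0 hc hm hc' hm').inter isOpen_Ioi).measurableSet (fun w hw => (hsub hw).1)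
    measurableSet_Ioo hw
    (lintegral_quantileGap_ne_zero hc hm hc' hm' (by linarith) hsub)
    -- To the right of the mode the density decreases, so the right endpoint is now the comparison
    -- level.
    (fun m => orderDensity_pos (hq m) hd.1.1) ?_ ?_ ?_
  · refine tendsto_orderDensity_div hq hq hlim hlim ⟨hc0, hc1⟩ hd.1.1 ?_
    exact (add_lt_add_iff_right _).2
      (crossLog_lt_of_le_of_lt hd.1.1.1 hd.2.1.le hd.2.2 hc1 hγ)
  · filter_upwards [hlim.eventually_lt_const (huγ.trans hcu), eventually_gt_atTop 0]
      with m hm1 hm0 w hw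
    exact orderDensity_le_of_le_right hm0 (hq m) hc0
      (extendCDF_pointD_le hc hm hc' hm' hw.1 hw.2) hw.1.1.2 hm1.le
  · filter_upwards [hlim.eventually_lt_const ha.2.1, eventually_gt_atTop 0] with m hm1 hm0 w hw
    exact orderDensity_le_of_le_right hm0 (hq m) (hsub hw).1.1 hw.2.le hd.1.1.2 (hm1.trans hw.1).le

lemma negligibleOn_setA0 (hc : Continuous (cdf μ)) (hm : StrictMono (cdf μ))
    (hc' : Continuous (cdf ν)) (hm' : StrictMono (cdf ν))
    (hw : ∫⁻ v in Ioo (0 : ℝ) 1, quantileGap (cdf μ) (cdf ν) v ≠ ∞)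
    (hq : ∀ m, q m ≤ m) (hγ : γ ∈ Icc (0 : ℝ) 1)
    (hlim : Tendsto (fun m : ℕ => (q m : ℝ) / m) atTop (𝓝 γ))
    (hleft : (setA2 (cdf μ) (cdf ν) ∩ Ioo 0 γ).Nonempty →
      extendCDF (cdf μ) (pointC (cdf μ) (cdf ν) γ)
        < extendCDF (cdf μ) (pointA (cdf μ) (cdf ν) γ))
    (hright : (setA2 (cdf μ) (cdf ν) ∩ Ioo γ 1).Nonempty →
      extendCDF (cdf μ) (pointB (cdf μ) (cdf ν) γ)
        < extendCDF (cdf μ) (pointD (cdf μ) (cdf ν) γ)) :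
    NegligibleOn (fun m => orderDensity m (q m)) (quantileGap (cdf μ) (cdf ν))
      (setA0 (cdf μ) (cdf ν)) := by
  refine (((negligibleOn_left hc hm hc' hm' hw hq hγ.2 hlim hleft).union
    (negligibleOn_right hc hm hc' hm' hw hq hγ.1 hlim hright)).union
    (negligibleOn_of_null (S := {γ}) (by simp))).mono fun v hv => ?_
  rcases lt_trichotomy v γ with h | h | h
  · exact Or.inl (Or.inl ⟨hv, h⟩)
  · exact Or.inr h
  · exact Or.inl (Or.inr ⟨hv, h⟩)

end

/-! ### From single densities to mixtures, and the departure limit -/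

lemma ofReal_mixtureDensity_mul {p : ℕ} {α : Fin p → ℝ} (hα : ∀ i, 0 < α i) (g : Fin p → ℝ)
    (m : ℕ) (w : ℝ → ℝ≥0∞) {v : ℝ} (hv : v ∈ Icc (0 : ℝ) 1) :
    ENNReal.ofReal (mixtureDensity α g m v) * w v = ∑ i, ENNReal.ofReal (α i) *
      (ENNReal.ofReal (orderDensity m (lowerIndex m (g i)) v) * w v) := by
  rw [mixtureDensity, ENNReal.ofReal_sum_of_nonneg
    (fun i _ => mul_nonneg (hα i).le (orderDensity_nonneg _ _ hv)), Finset.sum_mul]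
  exact Finset.sum_congr rfl fun i _ => by rw [ENNReal.ofReal_mul (hα i).le, mul_assoc]

lemma setLIntegral_mixtureDensity {p : ℕ} {α : Fin p → ℝ} (hα : ∀ i, 0 < α i) (g : Fin p → ℝ)
    (m : ℕ) {w : ℝ → ℝ≥0∞} (hw : AEMeasurable w (volume.restrict (Ioo 0 1))) {S : Set ℝ}
    (hS : MeasurableSet S) (hS' : S ⊆ Ioo 0 1) :
    ∫⁻ v in S, ENNReal.ofReal (mixtureDensity α g m v) * w v = ∑ i, ENNReal.ofReal (α i) *
      ∫⁻ v in S, ENNReal.ofReal (orderDensity m (lowerIndex m (g i)) v) * w v := by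
  rw [setLIntegral_congr_fun hS fun v hv =>
    ofReal_mixtureDensity_mul hα g m w (Ioo_subset_Icc_self (hS' hv))]
  have hae : ∀ i ∈ Finset.univ, AEMeasurable (fun v => ENNReal.ofReal (α i) *
      (ENNReal.ofReal (orderDensity m (lowerIndex m (g i)) v) * w v)) (volume.restrict S) :=
    fun i _ => ((continuous_orderDensity m _).measurable.ennreal_ofReal.aemeasurable.mul
      (hw.mono_set hS')).const_mul _
  rw [lintegral_finsetSum' _ hae]
  exact Finset.sum_congr rfl fun i _ => lintegral_const_mul' _ _ ENNReal.ofReal_ne_top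

/-- Both sides of the inequality defining negligibility are linear in the density, so components
with the same `ε` add up, without any comparison between different components. -/
lemma negligibleOn_mixtureDensity {p : ℕ} {α : Fin p → ℝ} (hα : ∀ i, 0 < α i)
    {g : ℕ → Fin p → ℝ} {w : ℝ → ℝ≥0∞} (hw : AEMeasurable w (volume.restrict (Ioo 0 1)))
    {S : Set ℝ} (hS : MeasurableSet S) (hS' : S ⊆ Ioo 0 1)
    (h : ∀ i, NegligibleOn (fun m => orderDensity m (lowerIndex m (g m i))) w S) :
    NegligibleOn (fun m => mixtureDensity α (g m) m) w S := by
  intro ε hε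
  filter_upwards [eventually_all.2 fun i => h i ε hε] with m hm
  rw [setLIntegral_mixtureDensity hα (g m) m hw hS hS',
    setLIntegral_mixtureDensity hα (g m) m hw measurableSet_Ioo subset_rfl, Finset.mul_sum]
  refine Finset.sum_le_sum fun i _ => ?_
  rw [mul_left_comm]
  gcongr
  exact hm i

lemma mixtureDensity_le {p : ℕ} {α g : Fin p → ℝ} (hα : ∀ i, 0 < α i) (hα_sum : ∑ i, α i = 1)
    (hg : ∀ i, g i ≤ 1) (m : ℕ) {u : ℝ} (hu : u ∈ Icc (0 : ℝ) 1) :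
    mixtureDensity α g m u ≤ (m : ℝ) + 1 := by
  calc mixtureDensity α g m u ≤ ∑ i, α i * ((m : ℝ) + 1) :=
        Finset.sum_le_sum fun i _ =>
          mul_le_mul_of_nonneg_left (orderDensity_le (lowerIndex_le m (hg i)) hu) (hα i).le
    _ = (m : ℝ) + 1 := by rw [← Finset.sum_mul, hα_sum, one_mul]

lemma tendsto_departure_mixtureDistortion {p : ℕ} {α γ : Fin p → ℝ} {g : ℕ → Fin p → ℝ}
    (hα : ∀ i, 0 < α i) (hα_sum : ∑ i, α i = 1) (hγ : ∀ i, γ i ∈ Icc (0 : ℝ) 1)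
    (hg : ∀ m i, g m i ≤ 1)
    (hlim : ∀ i, Tendsto (fun m : ℕ => (lowerIndex m (g m i) : ℝ) / m) atTop (𝓝 (γ i)))
    {μ ν : Measure ℝ} [IsProbabilityMeasure μ] [IsProbabilityMeasure ν]
    (hc : Continuous (cdf μ)) (hm : StrictMono (cdf μ)) (h2 : Integrable (fun x : ℝ => x ^ 2) μ)
    (hc' : Continuous (cdf ν)) (hm' : StrictMono (cdf ν))
    (h2' : Integrable (fun x : ℝ => x ^ 2) ν)
    (hleft : ∀ i, (setA2 (cdf μ) (cdf ν) ∩ Ioo 0 (γ i)).Nonempty →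
      extendCDF (cdf μ) (pointC (cdf μ) (cdf ν) (γ i))
        < extendCDF (cdf μ) (pointA (cdf μ) (cdf ν) (γ i)))
    (hright : ∀ i, (setA2 (cdf μ) (cdf ν) ∩ Ioo (γ i) 1).Nonempty →
      extendCDF (cdf μ) (pointB (cdf μ) (cdf ν) (γ i))
        < extendCDF (cdf μ) (pointD (cdf μ) (cdf ν) (γ i))) :
    Tendsto (fun m => departure (fun x => mixtureDistortion α (g m) (m + 1) (cdf μ x))
      (fun x => mixtureDistortion α (g m) (m + 1) (cdf ν x))) atTop (𝓝 0) := by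
  have hw := lintegral_quantileGap_ne_top hc hm h2 hc' hm' h2'
  have hA : MeasurableSet (setA0 (cdf μ) (cdf ν)) := (isOpen_setA0 hc hm hc' hm').measurableSet
  have hA' : setA0 (cdf μ) (cdf ν) ⊆ Ioo 0 1 := fun u hu => hu.1
  have hneg : NegligibleOn (fun m => mixtureDensity α (g m) m) (quantileGap (cdf μ) (cdf ν))
      (setA0 (cdf μ) (cdf ν)) :=
    negligibleOn_mixtureDensity hα (aemeasurable_quantileGap hc hm hc' hm') hA hA' fun i =>
      negligibleOn_setA0 hc hm hc' hm' hw (q := fun m => lowerIndex m (g m i))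
        (fun m => lowerIndex_le m (hg m i)) (hγ i) (hlim i) (hleft i) (hright i)
  refine ENNReal.tendsto_nhds_zero.2 fun ε hε => ?_
  filter_upwards [hneg ε hε] with m hle
  have hmono := strictMonoOn_mixtureDistortion hα hα_sum (hg m) m
  have hd := hasDerivAt_mixtureDistortion α (hg m) m
  have hnn : ∀ u ∈ Icc (0 : ℝ) 1, 0 ≤ mixtureDensity α (g m) m u :=
    fun u hu => mixtureDensity_nonneg hα (g m) m hu
  have h0 := mixtureDistortion_zero α (g m) (m + 1)
  have h1 := mixtureDistortion_one hα_sum (hg m) m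
  have hviol := violation_comp hmono hd hnn h0 h1 (cdf_mem_Icc μ) (cdf_mem_Icc ν) hA
  refine departure_le ?_ ?_
  · rw [hviol]
    -- For each fixed `m` the density is bounded by `m + 1`, so the violation is finite and the
    -- branch of `departure` with value `1` does not occur.
    refine ne_top_of_le_ne_top
      (ENNReal.mul_ne_top (ENNReal.ofReal_ne_top (r := (m : ℝ) + 1)) hw) ?_
    rw [← lintegral_const_mul' _ _ ENNReal.ofReal_ne_top]
    refine (setLIntegral_mono' hA fun v hv => ?_).trans (lintegral_mono_set hA')
    gcongr
    exact mixtureDensity_le hα hα_sum (hg m) m (Ioo_subset_Icc_self (hA' hv))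
  · rw [hviol, wasserstein2_comp_sq hmono hd hnn h0 h1 (cdf_mem_Icc μ) (cdf_mem_Icc ν)]
    exact hle

end

end DepartureOrder

theorem mainTheorem3 {p : ℕ} (α γ : Fin p → ℝ) (γn : ℕ → Fin p → ℝ)
    (hα : ∀ i, 0 < α i) (hα_sum : ∑ i, α i = 1)
    (hγ : ∀ i, γ i ∈ Icc (0 : ℝ) 1) (hγn : ∀ n i, γn n i ∈ Icc (0 : ℝ) 1)
    (hrate : ∀ i, (fun n : ℕ => γn n i - γ i) =O[atTop] (fun n : ℕ => 1 / (n : ℝ))) :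
    (∃ δ : Fin p → ℝ, DepartureOrder.ConcentrationRadii
      (fun n => DepartureOrder.mixtureDistortion α (γn n) n) γ δ) ∧
    ∀ δ : Fin p → ℝ, DepartureOrder.ConcentrationRadii
        (fun n => DepartureOrder.mixtureDistortion α (γn n) n) γ δ →
      ∀ (μX μY : Measure ℝ) [IsProbabilityMeasure μX] [IsProbabilityMeasure μY],
        Continuous (cdf μX) → StrictMono (cdf μX) → Integrable (fun x : ℝ => x ^ 2) μX →
        Continuous (cdf μY) → StrictMono (cdf μY) → Integrable (fun x : ℝ => x ^ 2) μY →
        DepartureOrder.CondA1 (cdf μX) (cdf μY) γ δ →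
        DepartureOrder.CondA2 (cdf μX) (cdf μY) γ δ →
        ∀ {Ω Ω' : ℕ → Type*} [∀ n, MeasurableSpace (Ω n)] [∀ n, MeasurableSpace (Ω' n)]
          (P : ∀ n, Measure (Ω n)) [∀ n, IsProbabilityMeasure (P n)]
          (Q : ∀ n, Measure (Ω' n)) [∀ n, IsProbabilityMeasure (Q n)]
          (X : ∀ n, Ω n → ℝ) (Y : ∀ n, Ω' n → ℝ),
          (∀ n, AEMeasurable (X n) (P n)) → (∀ n, AEMeasurable (Y n) (Q n)) →
          (∀ n, 1 ≤ n → ∀ x, cdf ((P n).map (X n)) x =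
            DepartureOrder.mixtureCDF α (γn n) μX n x) →
          (∀ n, 1 ≤ n → ∀ x, cdf ((Q n).map (Y n)) x =
            DepartureOrder.mixtureCDF α (γn n) μY n x) →
          DepartureOrder.DAstLE P X Q Y := by
  have hlim : ∀ i, Tendsto (fun n => γn n i) atTop (𝓝 (γ i)) :=
    fun i => DepartureOrder.tendsto_of_rate (hrate i)
  refine ⟨DepartureOrder.exists_concentrationRadii α γ γn hα hγ hγn hlim, ?_⟩
  intro δ _ μX μY _ _ hcX hmX h2X hcY hmY h2Y hA1 hA2 Ω Ω' _ _ P _ Q _ X Y _ _ hX hY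
  -- Passing to `n = m + 1` discards `n = 0`, where the cdfs are not prescribed.
  rw [DepartureOrder.DAstLE, ← tendsto_add_atTop_iff_nat 1]
  have hX' : ∀ m, ⇑(cdf ((P (m + 1)).map (X (m + 1))))
      = fun x => DepartureOrder.mixtureDistortion α (γn (m + 1)) (m + 1) (cdf μX x) := fun m =>
    funext fun x => (hX (m + 1) (by omega) x).trans
      (DepartureOrder.mixtureCDF_eq α (fun i => (hγn (m + 1) i).2) μX m x)
  have hY' : ∀ m, ⇑(cdf ((Q (m + 1)).map (Y (m + 1))))
      = fun x => DepartureOrder.mixtureDistortion α (γn (m + 1)) (m + 1) (cdf μY x) := fun m =>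
    funext fun x => (hY (m + 1) (by omega) x).trans
      (DepartureOrder.mixtureCDF_eq α (fun i => (hγn (m + 1) i).2) μY m x)
  simp only [hX', hY']
  exact DepartureOrder.tendsto_departure_mixtureDistortion (g := fun m => γn (m + 1)) hα hα_sum hγ
    (fun m i => (hγn (m + 1) i).2)
    (fun i => DepartureOrder.tendsto_index (g := fun n => γn n i) (fun n => hγn n i) (hlim i))
    hcX hmX h2X hcY hmY h2Y
    (fun i h => (le_max_left _ _).trans_lt (hA1 i h))
    (fun i h => (hA2 i h).trans_le (min_le_left _ _))
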